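/- Let $\alpha<\beta$ be in $[-\infty,+\infty]$, not $\alpha=-\infty$ and $\beta=+\infty$ simultaneously. On the Hilbert space $\ell^2(\mathbb{Z}^2)$ with standard basis $(e_{m,n})$, let $M_{m,n}$ be the translation $(M_{m,n}\varphi)(k,l)=\varphi(k-m,l-n)$. Put $$\Sigma^\alpha=\{(x,y)\in\mathbb{Z}^2: -\alpha x+y\ge 0\},\qquad \Sigma^\beta=\{(x,y)\in\mathbb{Z}^2: -\beta x+y\le 0\},\qquad \check\Sigma=\Sigma^\alpha\cup\Sigma^\beta,$$ where $\Sigma^{\alpha}$ for $\alpha=-\infty$ and $\Sigma^{\beta}$ for $\beta=+\infty$ mean $\{(x,y)\in\mathbb{Z}^2: x\ge 0\}$. Let $\mathcal{H}^\alpha,\mathcal{H}^\beta,\check{\mathcal{H}}^{\alpha,\beta}$ be the closed subspaces of $\ell^2(\mathbb{Z}^2)$ spanned by the $e_{x,y}$ with $(x,y)$ in $\Sigma^\alpha,\Sigma^\beta,\check\Sigma$, let $P^\alpha,P^\beta,\check P^{\alpha,\beta}$ be the orthogonal projections onto them, and let $\mathcal{T}^\alpha\subset B(\mathcal{H}^\alpha)$,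 $\mathcal{T}^\beta\subset B(\mathcal{H}^\beta)$, $\check{\mathcal{T}}^{\alpha,\beta}\subset B(\check{\mathcal{H}}^{\alpha,\beta})$ be the $C^*$-algebras generated by the compressions $P^\alpha M_{m,n}P^\alpha$, $P^\beta M_{m,n}P^\beta$, $\check P^{\alpha,\beta}M_{m,n}\check P^{\alpha,\beta}$, $(m,n)\in\mathbb{Z}^2$, respectively. There are surjective $*$-homomorphisms $\sigma^\alpha\colon\mathcal{T}^\alpha\to C(\mathbb{T}^2)$ and $\sigma^\beta\colon\mathcal{T}^\beta\to C(\mathbb{T}^2)$ that send $P^\alpha M_{m,n}P^\alpha$ and $P^\beta M_{m,n}P^\beta$, respectively, to $\chi_{m,n}(\xi,\eta)=\xi^m\eta^n$ for all $(m,n)\in\mathbb{Z}^2$ (they are determined by this). With the pullback $$\mathcal{S}^{\alpha,\beta}=\{(A,B)\in\mathcal{T}^\alpha\oplus\mathcal{T}^\beta:\ \sigma^\alpha(A)=\sigma^\beta(B)\},$$ there is a short exact sequence of $C^*$-algebras $$0\to K(\check{\mathcal{H}}^{\alpha,\beta})\to\check{\mathcal{T}}^{\alpha,\beta}\xrightarrow{\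 \check\gamma\ }\mathcal{S}^{\alpha,\beta}\to 0,$$ where $K(\check{\mathcal{H}}^{\alpha,\beta})$ is the algebra of compact operators on $\check{\mathcal{H}}^{\alpha,\beta}$, the first map is the inclusion (so every compact operator lies in $\check{\mathcal{T}}^{\alpha,\beta}$), and $\check\gamma$ is a $*$-homomorphism with $\check\gamma(\check P^{\alpha,\beta}M_{m,n}\check P^{\alpha,\beta})=(P^\alpha M_{m,n}P^\alpha,\,P^\beta M_{m,n}P^\beta)$ for all $(m,n)\in\mathbb{Z}^2$. -/

import Mathlib

open scoped ENNReal

noncomputable section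

namespace ConcaveCorner

/-! ## Translations on the square lattice -/

/-- The Hilbert space `ℓ²(ℤ²)`, with the structure of Mathlib's `lp`. -/
def LatticeSpace : Type := lp (fun _ : ℤ × ℤ => ℂ) 2

instance : NormedAddCommGroup LatticeSpace :=
  inferInstanceAs (NormedAddCommGroup (lp (fun _ : ℤ × ℤ => ℂ) 2))

instance : InnerProductSpace ℂ LatticeSpace :=
  inferInstanceAs (InnerProductSpace ℂ (lp (fun _ : ℤ × ℤ => ℂ) 2))

instance : CompleteSpace LatticeSpace :=
  inferInstanceAs (CompleteSpace (lp (fun _ : ℤ × ℤ => ℂ) 2))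

/-- The function that is `1` at the lattice point `p` and `0` elsewhere. -/
def basisVec (p : ℤ × ℤ) : LatticeSpace :=
  (lp.single 2 p (1 : ℂ) : lp (fun _ : ℤ × ℤ => ℂ) 2)

theorem memlp_translate (m n : ℤ) (φ : lp (fun _ : ℤ × ℤ => ℂ) 2) :
    Memℓp (fun p : ℤ × ℤ => φ (p.1 - m, p.2 - n)) 2 := by
  have h := lp.memℓp φ
  rw [memℓp_gen_iff (by norm_num)] at h ⊢
  exact ((Equiv.subRight ((m, n) : ℤ × ℤ)).summable_iff (f := fun q => ‖φ q‖ ^ (2 : ℝ≥0∞).toReal)).2 h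

/-- The translation operator on `ℓ²(ℤ²)`: `(M_{m,n} φ)(k, l) = φ (k - m, l - n)`. -/
def translation (m n : ℤ) : LatticeSpace →L[ℂ] LatticeSpace :=
  LinearMap.mkContinuous
    (show lp (fun _ : ℤ × ℤ => ℂ) 2 →ₗ[ℂ] lp (fun _ : ℤ × ℤ => ℂ) 2 from
    { toFun := fun φ => ⟨fun p => φ (p.1 - m, p.2 - n), memlp_translate m n φ⟩
      map_add' := fun _ _ => rfl
      map_smul' := fun _ _ => rfl }) 1
    (fun φ : lp (fun _ : ℤ × ℤ => ℂ) 2 => by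
      rw [one_mul]
      refine (lp.norm_eq_tsum_rpow (by norm_num) _).trans_le
        (le_of_eq (Eq.trans ?_ (lp.norm_eq_tsum_rpow (by norm_num) φ).symm))
      exact congrArg (· ^ (1 / (2 : ℝ≥0∞).toReal))
        ((Equiv.subRight ((m, n) : ℤ × ℤ)).tsum_eq (fun q => ‖φ q‖ ^ (2 : ℝ≥0∞).toReal)))

theorem translation_apply (m n : ℤ) (φ : LatticeSpace) (k l : ℤ) :
    (translation m n φ).1 (k, l) = φ.1 (k - m, l - n) := rfl

/-! ## Half-planes and the concave corner -/

/-- The lattice points of the half-plane `-α x + y ≥ 0`; for the slope `α = -∞` this is the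
half-plane `x ≥ 0`. (The value `α = +∞` is never used.) -/
def halfPlaneAbove (α : EReal) : Set (ℤ × ℤ) :=
  {p | (α = ⊥ ∧ 0 ≤ p.1) ∨ (α ≠ ⊥ ∧ 0 ≤ -α.toReal * (p.1 : ℝ) + (p.2 : ℝ))}

/-- The lattice points of the half-plane `-β x + y ≤ 0`; for the slope `β = +∞` this is the
half-plane `x ≥ 0`. (The value `β = -∞` is never used.) -/
def halfPlaneBelow (β : EReal) : Set (ℤ × ℤ) :=
  {p | (β = ⊤ ∧ 0 ≤ p.1) ∨ (β ≠ ⊤ ∧ -β.toReal * (p.1 : ℝ) + (p.2 : ℝ) ≤ 0)}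

/-- The lattice points of the concave corner: the union of the two half-planes. -/
def concaveCorner (α β : EReal) : Set (ℤ × ℤ) := halfPlaneAbove α ∪ halfPlaneBelow β

/-! ## Toeplitz algebras -/

/-- The closed subspace of `ℓ²(ℤ²)` spanned by the basis vectors at the points of `S`. -/
def supportedOn (S : Set (ℤ × ℤ)) : Submodule ℂ LatticeSpace :=
  (Submodule.span ℂ (basisVec '' S)).topologicalClosure

instance (S : Set (ℤ × ℤ)) : CompleteSpace (supportedOn S) :=
  Submodule.topologicalClosure.completeSpace _

/-- The closed subspace `supportedOn S`, regarded as a Hilbert space of its own. -/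
def SubHilbert (S : Set (ℤ × ℤ)) : Type := supportedOn S

instance (S : Set (ℤ × ℤ)) : NormedAddCommGroup (SubHilbert S) :=
  inferInstanceAs (NormedAddCommGroup (supportedOn S))

instance (S : Set (ℤ × ℤ)) : InnerProductSpace ℂ (SubHilbert S) :=
  inferInstanceAs (InnerProductSpace ℂ (supportedOn S))

instance (S : Set (ℤ × ℤ)) : CompleteSpace (SubHilbert S) :=
  inferInstanceAs (CompleteSpace (supportedOn S))

/-- The inclusion of the closed subspace into `ℓ²(ℤ²)`. -/
def incl (S : Set (ℤ × ℤ)) : SubHilbert S →L[ℂ] LatticeSpace := (supportedOn S).subtypeL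

/-- The orthogonal projection of `ℓ²(ℤ²)` onto the closed subspace. -/
def proj (S : Set (ℤ × ℤ)) : LatticeSpace →L[ℂ] SubHilbert S :=
  (supportedOn S).orthogonalProjectionOnto

/-- The compression `P M_{m,n} P` of a translation to the subspace spanned by the points of `S`,
where `P` is the orthogonal projection onto it, as an operator on that subspace. -/
def compression (S : Set (ℤ × ℤ)) (m n : ℤ) : SubHilbert S →L[ℂ] SubHilbert S :=
  proj S ∘L translation m n ∘L incl S

/-- The C*-algebra generated by the compressed translations to `S`: the norm closure of the
`*`-algebra that they generate. (It contains the identity, the compression of `M_{0,0}`.) -/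
def toeplitzAlgebra (S : Set (ℤ × ℤ)) : StarSubalgebra ℂ (SubHilbert S →L[ℂ] SubHilbert S) :=
  (StarAlgebra.adjoin ℂ
    (Set.range fun v : ℤ × ℤ => compression S v.1 v.2)).topologicalClosure

/-- The compressed translation as an element of the Toeplitz algebra. -/
def toeplitzGen (S : Set (ℤ × ℤ)) (m n : ℤ) : toeplitzAlgebra S :=
  ⟨compression S m n, StarSubalgebra.le_topologicalClosure _
    (StarAlgebra.subset_adjoin ℂ _ ⟨(m, n), rfl⟩)⟩

/-! ## The symbol maps and their pullback -/

/-- The monomial `χ_{m,n}(ξ, η) = ξ ^ m * η ^ n` on the torus. -/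
def monomial (m n : ℤ) : C(Circle × Circle, ℂ) where
  toFun z := ((z.1 ^ m * z.2 ^ n : Circle) : ℂ)
  continuous_toFun := by
    have h : Continuous fun z : Circle × Circle => z.1 ^ m * z.2 ^ n :=
      (continuous_fst.zpow m).mul (continuous_snd.zpow n)
    exact continuous_subtype_val.comp h

/-- `σ` is the symbol map of the Toeplitz algebra over `S`: the surjective `*`-homomorphism onto
`C(𝕋²)` that sends each compressed translation to the corresponding monomial. -/
def IsSymbolMap {S : Set (ℤ × ℤ)} (σ : toeplitzAlgebra S →⋆ₐ[ℂ] C(Circle × Circle, ℂ)) : Prop :=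
  Function.Surjective σ ∧ ∀ m n : ℤ, σ (toeplitzGen S m n) = monomial m n

/-- The pullback `{(A, B) | σ A = τ B}` of two `*`-homomorphisms, inside the direct sum. -/
def pullback {A B C : Type*} [Semiring A] [StarRing A] [Algebra ℂ A]
    [Semiring B] [StarRing B] [Algebra ℂ B] [Semiring C] [StarRing C] [Algebra ℂ C]
    [StarModule ℂ A] [StarModule ℂ B] (σ : A →⋆ₐ[ℂ] C) (τ : B →⋆ₐ[ℂ] C) :
    StarSubalgebra ℂ (A × B) :=
  StarAlgHom.equalizer (σ.comp (StarAlgHom.fst ℂ A B)) (τ.comp (StarAlgHom.snd ℂ A B))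

/-! ## Compact operators -/

theorem isCompactOperator_adjoint {E : Type*} [NormedAddCommGroup E] [InnerProductSpace ℂ E]
    [CompleteSpace E] {T : E →L[ℂ] E} (hT : IsCompactOperator T) :
    IsCompactOperator (ContinuousLinearMap.adjoint T) := by
  set A := ContinuousLinearMap.adjoint T with hA
  have hS : IsCompactOperator (T ∘L A) := hT.comp_clm A
  have key : ∀ x ∈ Metric.ball (0 : E) 1, ∀ y ∈ Metric.ball (0 : E) 1,
      ‖A x - A y‖ ^ 2 ≤ 2 * ‖(T ∘L A) x - (T ∘L A) y‖ := by
    intro x hx y hy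
    have hx' : ‖x‖ < 1 := by simpa using hx
    have hy' : ‖y‖ < 1 := by simpa using hy
    have h2 : ‖x - y‖ ≤ 2 := (norm_sub_le x y).trans (by linarith)
    have h1 : ‖A (x - y)‖ ^ 2 = RCLike.re (inner ℂ ((T ∘L A) (x - y)) (x - y)) := by
      rw [← inner_self_eq_norm_sq (𝕜 := ℂ), ContinuousLinearMap.comp_apply, hA,
        ContinuousLinearMap.adjoint_inner_right]
    rw [← map_sub, ← map_sub, h1]
    calc RCLike.re (inner ℂ ((T ∘L A) (x - y)) (x - y))
        ≤ ‖(T ∘L A) (x - y)‖ * ‖x - y‖ := re_inner_le_norm _ _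
      _ ≤ ‖(T ∘L A) (x - y)‖ * 2 := by gcongr
      _ = 2 * ‖(T ∘L A) (x - y)‖ := mul_comm _ _
  have htb : TotallyBounded (((T ∘L A : E →L[ℂ] E) : E → E) '' Metric.ball (0 : E) 1) :=
    (IsCompactOperator.isCompact_closure_image_ball (f := ((T ∘L A : E →L[ℂ] E) : E →ₗ[ℂ] E))
      hS 1).totallyBounded.subset subset_closure
  have htb' : TotallyBounded ((A : E → E) '' Metric.ball (0 : E) 1) := by
    rw [Metric.totallyBounded_iff]
    intro ε hε
    obtain ⟨t, hts, htf, hcov⟩ := Metric.finite_approx_of_totallyBounded htb (ε ^ 2 / 2)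
      (by positivity)
    have hts' : ∀ y ∈ t, ∃ x ∈ Metric.ball (0 : E) 1, (T ∘L A) x = y := fun y hy => hts hy
    choose! g hg using hts'
    refine ⟨(fun y => A (g y)) '' t, htf.image _, ?_⟩
    rintro _ ⟨x, hx, rfl⟩
    have := hcov (Set.mem_image_of_mem _ hx)
    simp only [Set.mem_iUnion] at this
    obtain ⟨y, hy, hxy⟩ := this
    simp only [Set.mem_iUnion]
    refine ⟨A (g y), ⟨y, hy, rfl⟩, ?_⟩
    have h := key x hx (g y) (hg y hy).1
    rw [(hg y hy).2] at h
    rw [Metric.mem_ball, dist_eq_norm] at hxy ⊢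
    exact lt_of_pow_lt_pow_left₀ 2 hε.le (by linarith)
  rw [isCompactOperator_iff_exists_mem_nhds_isCompact_closure_image]
  exact ⟨Metric.ball 0 1, Metric.ball_mem_nhds 0 one_pos,
    htb'.closure.isCompact_of_isClosed isClosed_closure⟩

/-- The C*-algebra `K(E)` of compact operators on a Hilbert space. -/
def compactOperators (E : Type*) [NormedAddCommGroup E] [InnerProductSpace ℂ E]
    [CompleteSpace E] : NonUnitalStarSubalgebra ℂ (E →L[ℂ] E) where
  carrier := {T | IsCompactOperator T}
  add_mem' ha hb := IsCompactOperator.add ha hb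
  zero_mem' := isCompactOperator_zero
  smul_mem' c _ ha := IsCompactOperator.smul ha c
  mul_mem' {_ b} ha _ := IsCompactOperator.comp_clm ha b
  star_mem' ha := isCompactOperator_adjoint ha

end ConcaveCorner

end

noncomputable section

namespace ConcaveCorner

/-! The half-planes are `upper a` and `upper b` for two linearly independent functionals `a`, `b`,
and the corner `S` is their union; the argument uses only the properties of `a`, `b` collected in
`IsCorner`. A product of generators (a `word`) moves a basis vector along a path and kills it as
soon as the path leaves the set. Words span a dense subspace, so linear continuous statements need
only be checked on words.

Homomorphisms come from limits of translates. Seen from far along one of its boundary rays, `S`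
looks like one half-plane; seen from deep inside, a half-plane looks like all of `ℤ²`. Passing to
such a limit does not increase the norm of `*`-polynomials in the generators (`exists_limitHom`).
This yields both components of `γ` and, since the algebra of `ℤ²` is `C(𝕋²)` by Gelfand theory, the
symbol maps. Compressed convolution is a linear section `toeplitz` of the symbol.

The kernel is found by comparing a word with the generator of equal symbol. They differ only near
the boundary of `S`, and away from the vertex the difference is the one on a half-plane, truncated
to a `wing`. Thus, modulo compacts, an element of the corner algebra is determined by its symbol and
its two half-plane images (`isCompactOperator_defectWord_sub`). Conversely, a product of diagonal
projections is nonzero of finite rank on `S` but vanishes on both half-planes; its ideal contains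
all matrix units, hence all compacts (`exists_eq_of_isCompactOperator_corner`).

For surjectivity, the projection onto `S ∩ (S + u)`, for suitable `u`, keeps one boundary ray and
removes the other. Multiplying a defect by it realizes the truncation up to a compact operator
(`exists_lift_defectWord`), and a pair is lifted by adding the two truncated defects to the Toeplitz
operator of the common symbol (`exists_lift`). -/

/-- The Toeplitz algebras over `Sa` and `Sb` have symbol maps, and the Toeplitz algebra over `S` is
an extension of their pullback by the compact operators. -/
def HasExactSequence (S Sa Sb : Set (ℤ × ℤ)) : Prop :=
  ∃ (σα : toeplitzAlgebra Sa →⋆ₐ[ℂ] C(Circle × Circle, ℂ))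
    (σβ : toeplitzAlgebra Sb →⋆ₐ[ℂ] C(Circle × Circle, ℂ)),
    IsSymbolMap σα ∧ IsSymbolMap σβ ∧
    ∃ (ι : compactOperators (SubHilbert S) →⋆ₙₐ[ℂ] toeplitzAlgebra S)
      (γ : toeplitzAlgebra S →⋆ₐ[ℂ] pullback σα σβ),
      (∀ T, (ι T).1 = T.1) ∧
      (∀ m n : ℤ, (γ (toeplitzGen S m n)).1 = (toeplitzGen Sa m n, toeplitzGen Sb m n)) ∧
      Function.Injective ι ∧ Function.Exact ι γ ∧ Function.Surjective γ

/-! ## Basis vectors and transfers between subspaces -/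

/-- The image in `SubHilbert S` of the basis vector at `p`; it vanishes for `p ∉ S`. -/
def ket (S : Set (ℤ × ℤ)) (p : ℤ × ℤ) : SubHilbert S := proj S (basisVec p)

theorem inner_basisVec_left (p : ℤ × ℤ) (x : LatticeSpace) : inner ℂ (basisVec p) x = x.1 p := by
  have h := lp.inner_single_left (𝕜 := ℂ) (G := fun _ : ℤ × ℤ => ℂ) p (1 : ℂ) x
  refine h.trans ?_
  simp

theorem basisVec_apply (p q : ℤ × ℤ) : (basisVec p).1 q = if q = p then 1 else 0 := by
  refine (lp.single_apply (E := fun _ : ℤ × ℤ => ℂ) 2 p (1 : ℂ) q).trans ?_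
  rw [Pi.single_apply]

theorem basisVec_mem {S : Set (ℤ × ℤ)} {p : ℤ × ℤ} (hp : p ∈ S) : basisVec p ∈ supportedOn S :=
  Submodule.le_topologicalClosure _ (Submodule.subset_span ⟨p, hp, rfl⟩)

theorem incl_ket {S : Set (ℤ × ℤ)} {p : ℤ × ℤ} (hp : p ∈ S) : incl S (ket S p) = basisVec p :=
  Submodule.starProjection_eq_self_iff.2 (basisVec_mem hp)

theorem incl_injective (S : Set (ℤ × ℤ)) : Function.Injective (incl S) := Subtype.val_injective

theorem norm_incl (S : Set (ℤ × ℤ)) (x : SubHilbert S) : ‖incl S x‖ = ‖x‖ := rfl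

theorem inner_proj_left (S : Set (ℤ × ℤ)) (x : LatticeSpace) (y : SubHilbert S) :
    inner ℂ (proj S x) y = inner ℂ x (incl S y) :=
  Submodule.inner_orthogonalProjectionOnto_eq_of_mem_right (K := supportedOn S) y x

theorem norm_proj_le (S : Set (ℤ × ℤ)) (x : LatticeSpace) : ‖proj S x‖ ≤ ‖x‖ :=
  Submodule.norm_orthogonalProjectionOnto_apply_le (supportedOn S) x

theorem supportedOn_apply {S : Set (ℤ × ℤ)} {p : ℤ × ℤ} (hp : p ∉ S) {x : LatticeSpace}
    (hx : x ∈ supportedOn S) : x.1 p = 0 := by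
  have h : supportedOn S ≤ (Submodule.span ℂ {basisVec p})ᗮ := by
    refine Submodule.topologicalClosure_minimal _ ?_ (Submodule.isClosed_orthogonal _)
    rw [Submodule.span_le]
    rintro _ ⟨q, hq, rfl⟩
    rw [SetLike.mem_coe, Submodule.mem_orthogonal_singleton_iff_inner_right, inner_basisVec_left,
      basisVec_apply, if_neg]
    rintro rfl
    exact hp hq
  have h' := h hx
  rwa [Submodule.mem_orthogonal_singleton_iff_inner_right, inner_basisVec_left] at h'

theorem incl_apply_of_notMem {S : Set (ℤ × ℤ)} {p : ℤ × ℤ} (hp : p ∉ S) (x : SubHilbert S) :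
    (incl S x).1 p = 0 := supportedOn_apply hp x.2

theorem inner_ket_left (S : Set (ℤ × ℤ)) (p : ℤ × ℤ) (x : SubHilbert S) :
    inner ℂ (ket S p) x = (incl S x).1 p := by
  rw [ket, inner_proj_left, inner_basisVec_left]

theorem ket_of_notMem {S : Set (ℤ × ℤ)} {p : ℤ × ℤ} (hp : p ∉ S) : ket S p = 0 := by
  rw [← inner_self_eq_zero (𝕜 := ℂ), inner_ket_left, incl_apply_of_notMem hp]

theorem inner_ket_ket {S : Set (ℤ × ℤ)} (p : ℤ × ℤ) {q : ℤ × ℤ} (hq : q ∈ S) :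
    inner ℂ (ket S p) (ket S q) = if p = q then 1 else 0 := by
  rw [inner_ket_left, incl_ket hq, basisVec_apply]

/-- The algebraic span of the basis vectors. -/
def kets (S : Set (ℤ × ℤ)) : Submodule ℂ (SubHilbert S) := Submodule.span ℂ (Set.range (ket S))

theorem ket_mem_kets (S : Set (ℤ × ℤ)) (p : ℤ × ℤ) : ket S p ∈ kets S :=
  Submodule.subset_span ⟨p, rfl⟩

theorem ext_inner_ket {S : Set (ℤ × ℤ)} {x y : SubHilbert S}
    (h : ∀ p ∈ S, (inner ℂ (ket S p) x : ℂ) = inner ℂ (ket S p) y) : x = y := by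
  refine incl_injective S (Subtype.ext (funext fun p => ?_))
  rw [← inner_ket_left, ← inner_ket_left]
  by_cases hp : p ∈ S
  · exact h p hp
  · rw [ket_of_notMem hp, inner_zero_left, inner_zero_left]

theorem topologicalClosure_kets (S : Set (ℤ × ℤ)) : (kets S).topologicalClosure = ⊤ := by
  rw [Submodule.topologicalClosure_eq_top_iff, Submodule.eq_bot_iff]
  intro x hx
  refine ext_inner_ket fun p _ => ?_
  rw [inner_zero_right]
  exact (Submodule.mem_orthogonal _ _).1 hx _ (ket_mem_kets S p)

theorem dense_kets (S : Set (ℤ × ℤ)) : Dense (kets S : Set (SubHilbert S)) :=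
  Submodule.dense_iff_topologicalClosure_eq_top.2 (topologicalClosure_kets S)

theorem clm_ext {S : Set (ℤ × ℤ)} {E : Type*} [NormedAddCommGroup E] [NormedSpace ℂ E]
    {A B : SubHilbert S →L[ℂ] E} (h : ∀ p ∈ S, A (ket S p) = B (ket S p)) : A = B := by
  refine ContinuousLinearMap.ext_on (dense_kets S) ?_
  rintro _ ⟨p, rfl⟩
  by_cases hp : p ∈ S
  · exact h p hp
  · rw [ket_of_notMem hp, map_zero, map_zero]

theorem norm_translation_le (m n : ℤ) (x : LatticeSpace) : ‖translation m n x‖ ≤ ‖x‖ := by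
  have h : ‖translation m n‖ ≤ 1 := LinearMap.mkContinuous_norm_le _ zero_le_one _
  simpa using (translation m n).le_of_opNorm_le h x

theorem norm_translation (m n : ℤ) (x : LatticeSpace) : ‖translation m n x‖ = ‖x‖ := by
  refine le_antisymm (norm_translation_le m n x) ?_
  have h : translation (-m) (-n) (translation m n x) = x := by
    refine Subtype.ext (funext fun p => ?_)
    obtain ⟨k, l⟩ := p
    rw [translation_apply, translation_apply]
    exact congrArg x.1 (Prod.ext (by simp) (by simp))
  calc ‖x‖ = ‖translation (-m) (-n) (translation m n x)‖ := by rw [h]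
    _ ≤ _ := norm_translation_le _ _ _

theorem translation_basisVec (v p : ℤ × ℤ) :
    translation v.1 v.2 (basisVec p) = basisVec (p + v) := by
  refine Subtype.ext (funext fun q => ?_)
  obtain ⟨k, l⟩ := q
  rw [translation_apply, basisVec_apply, basisVec_apply]
  congr 1
  simp only [Prod.ext_iff, Prod.fst_add, Prod.snd_add, sub_eq_iff_eq_add]

/-- The translation by `v`, compressed to an operator from `SubHilbert R` to `SubHilbert S`. -/
def transfer (R S : Set (ℤ × ℤ)) (v : ℤ × ℤ) : SubHilbert R →L[ℂ] SubHilbert S :=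
  proj S ∘L translation v.1 v.2 ∘L incl R

theorem compression_eq_transfer (S : Set (ℤ × ℤ)) (m n : ℤ) :
    compression S m n = transfer S S (m, n) := rfl

theorem transfer_ket {R : Set (ℤ × ℤ)} (S : Set (ℤ × ℤ)) (v : ℤ × ℤ) {p : ℤ × ℤ} (hp : p ∈ R) :
    transfer R S v (ket R p) = ket S (p + v) := by
  simp only [transfer, ContinuousLinearMap.comp_apply, incl_ket hp, translation_basisVec]
  rfl

theorem norm_transfer_apply_le (R S : Set (ℤ × ℤ)) (v : ℤ × ℤ) (x : SubHilbert R) :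
    ‖transfer R S v x‖ ≤ ‖x‖ :=
  (norm_proj_le _ _).trans ((norm_translation_le _ _ _).trans (norm_incl _ _).le)

/-- The generating family is closed under adjoints, so `*`-polynomials in the generators are linear
combinations of words. -/
theorem star_compression (S : Set (ℤ × ℤ)) (m n : ℤ) :
    star (compression S m n) = compression S (-m) (-n) := by
  rw [ContinuousLinearMap.star_eq_adjoint, compression_eq_transfer, compression_eq_transfer]
  refine clm_ext fun p hp => ext_inner_ket fun q hq => ?_
  rw [ContinuousLinearMap.adjoint_inner_right, transfer_ket S _ hp, transfer_ket S _ hq,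
    inner_ket_ket _ hp, ← inner_conj_symm, inner_ket_ket _ hq]
  have h : q + (m, n) = p ↔ p + (-m, -n) = q := by
    rw [← Prod.neg_mk, ← sub_eq_add_neg, sub_eq_iff_eq_add, eq_comm]
  simp only [h]
  split_ifs <;> simp

theorem compression_zero (S : Set (ℤ × ℤ)) : compression S 0 0 = 1 :=
  clm_ext fun p hp => by
    rw [compression_eq_transfer, transfer_ket S _ hp, ← Prod.zero_eq_mk, add_zero]
    rfl

/-! ## Homomorphisms determined on generators -/

/-- A family of pairs such that the second component of every `*`-polynomial in the pairs is
dominated in norm by the first defines a `*`-homomorphism on the generated C*-algebra. -/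
theorem exists_starAlgHom_of_norm_le {ι A B : Type*} [CStarAlgebra A] [CStarAlgebra B]
    (x : ι → A) (y : ι → B)
    (h : ∀ z ∈ StarAlgebra.adjoin ℂ (Set.range fun i => (x i, y i)), ‖z.2‖ ≤ ‖z.1‖) :
    ∃ φ : (StarAlgebra.adjoin ℂ (Set.range x)).topologicalClosure →⋆ₐ[ℂ] B,
      ∀ i (hi : x i ∈ (StarAlgebra.adjoin ℂ (Set.range x)).topologicalClosure),
        φ ⟨x i, hi⟩ = y i := by
  -- `G` is the closed graph of the desired map. The norm of a pair is the maximum of the two norms,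
  -- so by `h` the first projection is isometric on `G`; the map is its inverse followed by the
  -- second projection.
  set G := (StarAlgebra.adjoin ℂ (Set.range fun i => (x i, y i))).topologicalClosure with hG
  set Ac := (StarAlgebra.adjoin ℂ (Set.range x)).topologicalClosure with hAc
  have hGclosed : IsClosed (G : Set (A × B)) := StarSubalgebra.isClosed_topologicalClosure _
  have hmem : ∀ i, (x i, y i) ∈ G := fun i =>
    StarSubalgebra.le_topologicalClosure _ (StarAlgebra.subset_adjoin ℂ _ ⟨i, rfl⟩)
  have hle : ∀ z ∈ G, ‖z.2‖ ≤ ‖z.1‖ := by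
    intro z hz
    have hcl : IsClosed {z : A × B | ‖z.2‖ ≤ ‖z.1‖} :=
      isClosed_le continuous_snd.norm continuous_fst.norm
    exact hcl.closure_subset_iff.2 (fun z hz => h z hz) hz
  have hfst : ∀ z : G, z.1.1 ∈ Ac := by
    have : G ≤ Ac.comap (StarAlgHom.fst ℂ A B) := by
      refine StarSubalgebra.topologicalClosure_minimal (StarAlgebra.adjoin_le ?_)
        ((StarSubalgebra.isClosed_topologicalClosure _).preimage continuous_fst)
      rintro _ ⟨i, rfl⟩
      exact StarSubalgebra.le_topologicalClosure _ (StarAlgebra.subset_adjoin ℂ _ ⟨i, rfl⟩)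
    exact fun z => this z.2
  let f₀ : G →⋆ₐ[ℂ] A := (StarAlgHom.fst ℂ A B).comp G.subtype
  have hf₀ : Isometry f₀ := by
    refine AddMonoidHomClass.isometry_of_norm f₀ fun z => ?_
    exact (max_eq_left (hle z.1 z.2)).symm
  let f : G →⋆ₐ[ℂ] Ac := f₀.codRestrict Ac hfst
  have hcomplete : CompleteSpace G := hGclosed.completeSpace_coe
  have hsurj : Function.Surjective f := by
    -- An isometry from a complete space has closed range, so it suffices to hit the generators.
    have hle' : Ac ≤ f₀.range := by
      refine StarSubalgebra.topologicalClosure_minimal (StarAlgebra.adjoin_le ?_) ?_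
      · rintro _ ⟨i, rfl⟩
        exact ⟨⟨(x i, y i), hmem i⟩, rfl⟩
      · exact hf₀.isClosedEmbedding.isClosed_range
    rintro ⟨a, ha⟩
    obtain ⟨z, hz⟩ := hle' ha
    exact ⟨z, Subtype.ext hz⟩
  have hinj : Function.Injective f := fun z w hzw =>
    hf₀.injective (congrArg Subtype.val hzw)
  let e : G ≃⋆ₐ[ℂ] Ac := StarAlgEquiv.ofBijective f ⟨hinj, hsurj⟩
  refine ⟨((StarAlgHom.snd ℂ A B).comp G.subtype).comp (e.symm : Ac →⋆ₐ[ℂ] G), fun i hi => ?_⟩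
  have he : e.symm ⟨x i, hi⟩ = ⟨(x i, y i), hmem i⟩ := by
    rw [StarAlgEquiv.symm_apply_eq]
    rfl
  exact congrArg (fun z : G => z.1.2) he

theorem isClosed_toeplitzAlgebra (S : Set (ℤ × ℤ)) :
    IsClosed (toeplitzAlgebra S : Set (SubHilbert S →L[ℂ] SubHilbert S)) :=
  StarSubalgebra.isClosed_topologicalClosure _

/-- The C*-algebra structure of a Toeplitz algebra. -/
@[reducible]
def cstarAlgebraToeplitz (S : Set (ℤ × ℤ)) : CStarAlgebra (toeplitzAlgebra S) :=
  StarSubalgebra.cstarAlgebra _ (h_closed := isClosed_toeplitzAlgebra S)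

attribute [local instance] cstarAlgebraToeplitz

theorem continuous_starAlgHom {A B : Type*} [CStarAlgebra A] [CStarAlgebra B] (φ : A →⋆ₐ[ℂ] B) :
    Continuous φ :=
  AddMonoidHomClass.continuous_of_bound φ 1 fun a => by
    rw [one_mul]
    exact NonUnitalStarAlgHom.norm_apply_le φ a

/-! ## Words in the generators -/

/-- The generator of the Toeplitz algebra at a lattice vector. -/
def gen (S : Set (ℤ × ℤ)) (v : ℤ × ℤ) : toeplitzAlgebra S := toeplitzGen S v.1 v.2

/-- The product of the generators at the vectors of a list. -/
def word (S : Set (ℤ × ℤ)) (l : List (ℤ × ℤ)) : toeplitzAlgebra S := (l.map (gen S)).prod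

/-- If a family of generators is closed under `star`, then the `*`-algebra that it generates is
the algebra that it generates. -/
theorem mem_adjoin_of_mem_starAdjoin {A : Type*} [Ring A] [StarRing A] [Algebra ℂ A]
    [StarModule ℂ A] (f : ℤ × ℤ → A) (hf : ∀ v, star (f v) = f (-v)) {a : A}
    (ha : a ∈ StarAlgebra.adjoin ℂ (Set.range f)) : a ∈ Algebra.adjoin ℂ (Set.range f) := by
  have hstar : star (Set.range f) ⊆ Set.range f := by
    intro x hx
    obtain ⟨v, hv⟩ := Set.mem_star.1 hx
    exact ⟨-v, by rw [← hf, hv, star_star]⟩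
  rw [← Set.union_eq_self_of_subset_right hstar, ← StarAlgebra.adjoin_toSubalgebra]
  exact ha

/-- A closed subspace of the Toeplitz algebra that contains all words is everything. -/
theorem mem_of_word_mem {S : Set (ℤ × ℤ)} (V : Submodule ℂ (toeplitzAlgebra S))
    (hV : IsClosed (V : Set (toeplitzAlgebra S))) (hw : ∀ l, word S l ∈ V)
    (x : toeplitzAlgebra S) : x ∈ V := by
  obtain ⟨x, hx⟩ := x
  set s := Set.range fun v : ℤ × ℤ => compression S v.1 v.2 with hs
  let W : Submodule ℂ (SubHilbert S →L[ℂ] SubHilbert S) :=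
    V.map (toeplitzAlgebra S).subtype.toAlgHom.toLinearMap
  have hWclosed : IsClosed (W : Set (SubHilbert S →L[ℂ] SubHilbert S)) :=
    (isClosed_toeplitzAlgebra S).isClosedEmbedding_subtypeVal.isClosedMap _ hV
  have hsub : (StarAlgebra.adjoin ℂ s : Set (SubHilbert S →L[ℂ] SubHilbert S)) ⊆ W := by
    intro a ha
    have ha' : a ∈ Algebra.adjoin ℂ s :=
      mem_adjoin_of_mem_starAdjoin _ (fun v => star_compression S v.1 v.2) ha
    rw [← Subalgebra.mem_toSubmodule, Algebra.adjoin_eq_span] at ha'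
    refine Submodule.span_le.2 ?_ ha'
    intro b hb
    obtain ⟨l, hl, rfl⟩ := Submonoid.exists_list_of_mem_closure hb
    have hword : ∃ l', (word S l').1 = l.prod := by
      clear ha ha' hb
      induction l with
      | nil => exact ⟨[], rfl⟩
      | cons c l ih =>
        obtain ⟨l', hl'⟩ := ih fun y hy => hl y (List.mem_cons_of_mem _ hy)
        obtain ⟨v, rfl⟩ := hl c List.mem_cons_self
        refine ⟨v :: l', ?_⟩
        rw [List.prod_cons, ← hl']
        rfl
    obtain ⟨l', hl'⟩ := hword
    exact ⟨word S l', hw l', hl'⟩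
  obtain ⟨y, hy, hyx⟩ := hWclosed.closure_subset_iff.2 hsub hx
  have : y = ⟨x, hx⟩ := Subtype.ext hyx
  exact this ▸ hy

theorem map_word {S R : Set (ℤ × ℤ)} (φ : toeplitzAlgebra S →⋆ₐ[ℂ] toeplitzAlgebra R)
    (hφ : ∀ v, φ (gen S v) = gen R v) (l : List (ℤ × ℤ)) : φ (word S l) = word R l := by
  rw [word, map_list_prod, List.map_map, word]
  exact congrArg (fun f => (List.map f l).prod) (funext hφ)

-- The last letter acts first, so the points visited from `p` are `p` plus the sums of the tails of
-- `l`; the empty tail accounts for `p` itself.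
open Classical in
theorem word_ket (S : Set (ℤ × ℤ)) (l : List (ℤ × ℤ)) (p : ℤ × ℤ) :
    (word S l).1 (ket S p) = if ∀ t ∈ l.tails, p + t.sum ∈ S then ket S (p + l.sum) else 0 := by
  induction l with
  | nil =>
    have h : (word S []).1 = 1 := rfl
    simp only [h, List.tails, List.mem_singleton, forall_eq, List.sum_nil, add_zero]
    split_ifs with hp
    · rfl
    · rw [ket_of_notMem hp]; rfl
  | cons v l ih =>
    have h : (word S (v :: l)).1 = transfer S S v * (word S l).1 := rfl
    rw [h, mul_apply_eq_comp, ih]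
    simp only [List.tails_cons, List.mem_cons, forall_eq_or_imp, List.sum_cons]
    have hl : (∀ t ∈ l.tails, p + t.sum ∈ S) → p + l.sum ∈ S := fun h =>
      h l (by simp [List.mem_tails])
    split_ifs with h1 h2 h2
    · rw [transfer_ket S v (hl h1)]
      congr 1; abel
    · rw [transfer_ket S v (hl h1), show p + l.sum + v = p + (v + l.sum) by abel]
      exact ket_of_notMem fun h => h2 ⟨h, h1⟩
    · exact absurd h2.2 h1
    · exact map_zero _

/-! ## Limits along translations -/

/-- A `*`-homomorphism on a Toeplitz algebra takes values in every closed `*`-subalgebra that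
contains the images of the generators. -/
theorem apply_mem_of_gen_mem {S : Set (ℤ × ℤ)} {B : Type*} [CStarAlgebra B]
    (φ : toeplitzAlgebra S →⋆ₐ[ℂ] B) (D : StarSubalgebra ℂ B) (hD : IsClosed (D : Set B))
    (h : ∀ v, φ (gen S v) ∈ D) (x : toeplitzAlgebra S) : φ x ∈ D := by
  refine mem_of_word_mem (D.toSubalgebra.toSubmodule.comap φ.toAlgHom.toLinearMap)
    (hD.preimage (continuous_starAlgHom φ)) (fun l => ?_) x
  change φ (word S l) ∈ D
  rw [word, map_list_prod]
  refine list_prod_mem fun y hy => ?_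
  simp only [List.map_map, List.mem_map, Function.comp_apply] at hy
  obtain ⟨v, -, rfl⟩ := hy
  exact h v

/-- `*`-homomorphisms on a Toeplitz algebra that agree on the generators are equal. -/
theorem starAlgHom_eq_of_gen {S : Set (ℤ × ℤ)} {B : Type*} [CStarAlgebra B]
    {φ ψ : toeplitzAlgebra S →⋆ₐ[ℂ] B} (h : ∀ v, φ (gen S v) = ψ (gen S v)) : φ = ψ := by
  ext x
  refine mem_of_word_mem (LinearMap.eqLocus φ.toAlgHom.toLinearMap ψ.toAlgHom.toLinearMap)
    (isClosed_eq (continuous_starAlgHom φ) (continuous_starAlgHom ψ)) (fun l => ?_) x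
  change φ (word S l) = ψ (word S l)
  rw [word, map_list_prod, map_list_prod, List.map_map, List.map_map]
  exact congrArg (fun f => (List.map f l).prod) (funext h)

/-- A finitely supported vector is eventually translated entirely into `S`, where the projection
does nothing. Transfers are therefore eventually isometric on each such vector. -/
theorem eventually_incl_transfer {S R : Set (ℤ × ℤ)} {v : ℕ → ℤ × ℤ}
    (hv : ∀ p, ∀ᶠ k in Filter.atTop, (p + v k ∈ S ↔ p ∈ R)) {ξ : SubHilbert R}
    (hξ : ξ ∈ kets R) :
    ∀ᶠ k in Filter.atTop, incl S (transfer R S (v k) ξ) =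
      translation (v k).1 (v k).2 (incl R ξ) := by
  induction hξ using Submodule.span_induction with
  | mem x hx =>
    obtain ⟨p, rfl⟩ := hx
    by_cases hp : p ∈ R
    · filter_upwards [hv p] with k hk
      rw [transfer_ket S _ hp, incl_ket (hk.2 hp), incl_ket hp, translation_basisVec]
    · rw [ket_of_notMem hp]
      simp
  | zero => simp
  | add x y _ _ hx hy =>
    filter_upwards [hx, hy] with k h1 h2
    simp only [map_add, h1, h2]
  | smul c x _ hx =>
    filter_upwards [hx] with k h1
    simp only [map_smul, h1]

/-- If the translates `S - v k` converge pointwise to `R`, then the Toeplitz algebra over `R` is a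
quotient of the Toeplitz algebra over `S`. -/
theorem exists_limitHom {S R : Set (ℤ × ℤ)} (v : ℕ → ℤ × ℤ)
    (hv : ∀ p, ∀ᶠ k in Filter.atTop, (p + v k ∈ S ↔ p ∈ R)) :
    ∃ φ : toeplitzAlgebra S →⋆ₐ[ℂ] toeplitzAlgebra R, ∀ u, φ (gen S u) = gen R u := by
  let f : ℤ × ℤ → (SubHilbert S →L[ℂ] SubHilbert S) × (SubHilbert R →L[ℂ] SubHilbert R) :=
    fun u => (compression S u.1 u.2, compression R u.1 u.2)
  have hf : ∀ u, star (f u) = f (-u) := fun u =>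
    Prod.ext (star_compression S u.1 u.2) (star_compression R u.1 u.2)
  -- The transfers eventually intertwine the two components on each finitely supported vector.
  -- Preservation of finite support is part of the claim because products need it.
  have key : ∀ z ∈ StarAlgebra.adjoin ℂ (Set.range f), ∀ ξ ∈ kets R, z.2 ξ ∈ kets R ∧
      ∀ᶠ k in Filter.atTop, z.1 (transfer R S (v k) ξ) = transfer R S (v k) (z.2 ξ) := by
    intro z hz
    replace hz := mem_adjoin_of_mem_starAdjoin f hf hz
    induction hz using Algebra.adjoin_induction with
    | mem z hz =>
      obtain ⟨u, rfl⟩ := hz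
      intro ξ hξ
      induction hξ using Submodule.span_induction with
      | mem x hx =>
        obtain ⟨p, rfl⟩ := hx
        by_cases hp : p ∈ R
        · have h2 : (f u).2 (ket R p) = ket R (p + u) := transfer_ket R u hp
          refine ⟨h2 ▸ ket_mem_kets R _, ?_⟩
          filter_upwards [hv p, hv (p + u)] with k h1 h3
          rw [h2, transfer_ket S _ hp]
          refine (transfer_ket S u (h1.2 hp)).trans ?_
          rw [add_right_comm]
          by_cases hpu : p + u ∈ R
          · rw [transfer_ket S _ hpu]
          · rw [ket_of_notMem hpu, map_zero, ket_of_notMem (h3.not.2 hpu)]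
        · rw [ket_of_notMem hp]
          simp
      | zero => simp
      | add x y _ _ hx hy =>
        refine ⟨by rw [map_add]; exact add_mem hx.1 hy.1, ?_⟩
        filter_upwards [hx.2, hy.2] with k h1 h2
        simp only [map_add, h1, h2]
      | smul c x _ hx =>
        refine ⟨by rw [map_smul]; exact Submodule.smul_mem _ _ hx.1, ?_⟩
        filter_upwards [hx.2] with k h1
        simp only [map_smul, h1]
    | algebraMap r =>
      intro ξ hξ
      refine ⟨Submodule.smul_mem _ r hξ, Filter.Eventually.of_forall fun k => ?_⟩
      exact (map_smul (transfer R S (v k)) r ξ).symm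
    | add x y _ _ hx hy =>
      intro ξ hξ
      refine ⟨add_mem (hx ξ hξ).1 (hy ξ hξ).1, ?_⟩
      filter_upwards [(hx ξ hξ).2, (hy ξ hξ).2] with k h1 h2
      refine (congrArg₂ (· + ·) h1 h2).trans (map_add _ _ _).symm
    | mul x y _ _ hx hy =>
      intro ξ hξ
      have hy' := hy ξ hξ
      have hx' := hx _ hy'.1
      refine ⟨hx'.1, ?_⟩
      filter_upwards [hx'.2, hy'.2] with k h1 h2
      exact (congrArg x.1 h2).trans h1
  -- Transfers are contractions and eventually isometric on a given finitely supported vector, so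
  -- the bound for `z.1` passes to `z.2`.
  have hnorm : ∀ z ∈ StarAlgebra.adjoin ℂ (Set.range f), ‖z.2‖ ≤ ‖z.1‖ := by
    intro z hz
    have hdense : ∀ ξ ∈ kets R, ‖z.2 ξ‖ ≤ ‖z.1‖ * ‖ξ‖ := by
      intro ξ hξ
      obtain ⟨k, h1, h2⟩ :=
        ((key z hz ξ hξ).2.and (eventually_incl_transfer hv (key z hz ξ hξ).1)).exists
      calc ‖z.2 ξ‖ = ‖incl S (transfer R S (v k) (z.2 ξ))‖ := by
            rw [h2, norm_translation, norm_incl]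
        _ = ‖z.1 (transfer R S (v k) ξ)‖ := by rw [h1, norm_incl]
        _ ≤ ‖z.1‖ * ‖transfer R S (v k) ξ‖ := z.1.le_opNorm _
        _ ≤ ‖z.1‖ * ‖ξ‖ := by gcongr; exact norm_transfer_apply_le _ _ _ _
    refine ContinuousLinearMap.opNorm_le_bound _ (norm_nonneg _) fun ξ => ?_
    have hcl : IsClosed {ξ | ‖z.2 ξ‖ ≤ ‖z.1‖ * ‖ξ‖} :=
      isClosed_le z.2.continuous.norm (continuous_const.mul continuous_norm)
    exact hcl.closure_subset_iff.2 hdense (dense_kets R ξ)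
  obtain ⟨φ, hφ⟩ : ∃ φ : toeplitzAlgebra S →⋆ₐ[ℂ] (SubHilbert R →L[ℂ] SubHilbert R),
      ∀ u, φ (gen S u) = (gen R u).1 := by
    obtain ⟨φ, hφ⟩ := exists_starAlgHom_of_norm_le _ _ hnorm
    exact ⟨φ, fun u => hφ u (gen S u).2⟩
  refine ⟨φ.codRestrict (toeplitzAlgebra R) (apply_mem_of_gen_mem φ _
    (isClosed_toeplitzAlgebra R) fun u => ?_), fun u => Subtype.ext (hφ u)⟩
  rw [hφ]
  exact (gen R u).2

/-! ## Laurent polynomials on the torus -/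

theorem monomial_apply (m n : ℤ) (z : Circle × Circle) :
    monomial m n z = ((z.1 ^ m * z.2 ^ n : Circle) : ℂ) := rfl

theorem monomial_zero : monomial 0 0 = 1 := by
  ext z
  simp [monomial_apply]

theorem monomial_mul (m n k l : ℤ) : monomial m n * monomial k l = monomial (m + k) (n + l) := by
  ext z
  rw [ContinuousMap.mul_apply, monomial_apply, monomial_apply, monomial_apply, ← Circle.coe_mul,
    zpow_add, zpow_add, mul_mul_mul_comm]

theorem star_monomial (m n : ℤ) : star (monomial m n) = monomial (-m) (-n) := by
  ext z
  rw [ContinuousMap.star_apply, monomial_apply, monomial_apply, Complex.star_def,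
    ← Circle.coe_inv_eq_conj, mul_inv, zpow_neg, zpow_neg]

/-- The linear span of the monomials is dense in `C(𝕋²)`. -/
theorem mem_of_monomial_mem (V : Submodule ℂ C(Circle × Circle, ℂ))
    (hV : IsClosed (V : Set C(Circle × Circle, ℂ))) (hm : ∀ m n, monomial m n ∈ V)
    (f : C(Circle × Circle, ℂ)) : f ∈ V := by
  let g : ℤ × ℤ → C(Circle × Circle, ℂ) := fun u => monomial u.1 u.2
  have hsep : (StarAlgebra.adjoin ℂ (Set.range g)).SeparatesPoints := by
    intro z w hzw
    by_contra! h
    have h1 := h _ ⟨_, StarAlgebra.subset_adjoin ℂ _ ⟨(1, 0), rfl⟩, rfl⟩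
    have h2 := h _ ⟨_, StarAlgebra.subset_adjoin ℂ _ ⟨(0, 1), rfl⟩, rfl⟩
    simp only [g, monomial_apply, zpow_one, zpow_zero, mul_one, one_mul] at h1 h2
    exact hzw (Prod.ext (Circle.ext h1) (Circle.ext h2))
  have htop := ContinuousMap.starSubalgebra_topologicalClosure_eq_top_of_separatesPoints _ hsep
  have hsub : (StarAlgebra.adjoin ℂ (Set.range g) : Set C(Circle × Circle, ℂ)) ⊆ V := by
    intro a ha
    have ha' := mem_adjoin_of_mem_starAdjoin g (fun v => star_monomial v.1 v.2) ha
    rw [← Subalgebra.mem_toSubmodule, Algebra.adjoin_eq_span] at ha'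
    refine Submodule.span_le.2 ?_ ha'
    intro b hb
    obtain ⟨u, rfl⟩ : b ∈ Set.range g := by
      induction hb using Submonoid.closure_induction with
      | mem x hx => exact hx
      | one => exact ⟨0, monomial_zero⟩
      | mul x y _ _ hx hy =>
        obtain ⟨u, rfl⟩ := hx
        obtain ⟨v, rfl⟩ := hy
        exact ⟨u + v, (monomial_mul u.1 u.2 v.1 v.2).symm⟩
    exact hm u.1 u.2
  have hf : f ∈ (StarAlgebra.adjoin ℂ (Set.range g)).topologicalClosure :=
    htop ▸ StarSubalgebra.mem_top
  exact hV.closure_subset_iff.2 hsub hf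

/-! ## The Toeplitz algebra of the full lattice -/

theorem word_univ_ket (l : List (ℤ × ℤ)) (p : ℤ × ℤ) :
    (word Set.univ l).1 (ket Set.univ p) = ket Set.univ (p + l.sum) := by
  rw [word_ket, if_pos fun _ _ => Set.mem_univ _]

theorem gen_univ_ket (v p : ℤ × ℤ) :
    (gen Set.univ v).1 (ket Set.univ p) = ket Set.univ (p + v) :=
  transfer_ket _ _ (Set.mem_univ p)

/-- No path leaves the whole lattice, so words are honest translations and commute. The closure is
taken in one factor at a time. -/
theorem toeplitzAlgebra_univ_mul_comm (x y : toeplitzAlgebra Set.univ) : x * y = y * x := by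
  have h1 : ∀ (l : List (ℤ × ℤ)) (y : toeplitzAlgebra Set.univ),
      word Set.univ l * y = y * word Set.univ l := fun l y => by
    refine mem_of_word_mem (LinearMap.eqLocus (LinearMap.mulLeft ℂ (word Set.univ l))
      (LinearMap.mulRight ℂ (word Set.univ l))) (isClosed_eq (continuous_const_mul _)
        (continuous_mul_const _)) (fun k => Subtype.ext (clm_ext fun p _ => ?_)) y
    change (word Set.univ l).1 ((word Set.univ k).1 _) = (word Set.univ k).1 ((word Set.univ l).1 _)
    rw [word_univ_ket, word_univ_ket, word_univ_ket, word_univ_ket, add_right_comm]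
  exact (mem_of_word_mem (LinearMap.eqLocus (LinearMap.mulLeft ℂ x) (LinearMap.mulRight ℂ x))
    (isClosed_eq (continuous_const_mul _) (continuous_mul_const _)) (fun k => (h1 k x).symm) y)

/-- The commutative C*-algebra structure of the Toeplitz algebra over the whole lattice. -/
@[reducible]
def commCStarAlgebraToeplitzUniv : CommCStarAlgebra (toeplitzAlgebra Set.univ) :=
  { (inferInstance : CStarAlgebra (toeplitzAlgebra Set.univ)) with
    mul_comm := toeplitzAlgebra_univ_mul_comm }

attribute [local instance] commCStarAlgebraToeplitzUniv

theorem gen_zero (S : Set (ℤ × ℤ)) : gen S 0 = 1 := Subtype.ext (compression_zero S)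

theorem star_gen (S : Set (ℤ × ℤ)) (v : ℤ × ℤ) : star (gen S v) = gen S (-v) :=
  Subtype.ext (star_compression S v.1 v.2)

theorem gen_univ_add (u v : ℤ × ℤ) : gen Set.univ (u + v) = gen Set.univ u * gen Set.univ v :=
  Subtype.ext (clm_ext fun p _ => by
    change _ = (gen Set.univ u).1 ((gen Set.univ v).1 _)
    rw [gen_univ_ket, gen_univ_ket, gen_univ_ket, add_assoc, add_comm u v])

theorem norm_character_gen (φ : WeakDual.characterSpace ℂ (toeplitzAlgebra Set.univ))
    (v : ℤ × ℤ) : φ (gen Set.univ v) ∈ Submonoid.unitSphere ℂ := by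
  have h : star (φ (gen Set.univ v)) * φ (gen Set.univ v) = 1 := by
    rw [← map_star, ← map_mul, star_gen, ← gen_univ_add, neg_add_cancel, gen_zero, map_one]
  have h2 : ‖φ (gen Set.univ v)‖ * ‖φ (gen Set.univ v)‖ = 1 := by
    rw [← CStarRing.norm_star_mul_self, h, norm_one]
  refine mem_sphere_zero_iff_norm.2 ?_
  nlinarith [norm_nonneg (φ (gen Set.univ v))]

/-- The point of the torus given by a character of the algebra of translations. -/
def characterPoint : C(WeakDual.characterSpace ℂ (toeplitzAlgebra Set.univ), Circle × Circle) where
  toFun φ := (⟨φ (gen Set.univ (1, 0)), norm_character_gen φ _⟩,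
    ⟨φ (gen Set.univ (0, 1)), norm_character_gen φ _⟩)
  continuous_toFun := by
    have h : ∀ a : toeplitzAlgebra Set.univ,
        Continuous fun φ : WeakDual.characterSpace ℂ (toeplitzAlgebra Set.univ) => φ a :=
      fun a => (WeakDual.eval_continuous a).comp continuous_subtype_val
    exact ((h _).subtype_mk _).prodMk ((h _).subtype_mk _)

/-- On generators a character is a group homomorphism from `ℤ²` to the circle, hence fixed by its
values at `(1, 0)` and `(0, 1)`. -/
theorem character_gen (φ : WeakDual.characterSpace ℂ (toeplitzAlgebra Set.univ)) (m n : ℤ) :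
    φ (gen Set.univ (m, n)) = monomial m n (characterPoint φ) := by
  let F : Multiplicative (ℤ × ℤ) →* Circle :=
    { toFun := fun v => ⟨φ (gen Set.univ v.toAdd), norm_character_gen φ _⟩
      map_one' := Circle.ext (by
        change φ (gen Set.univ 0) = 1
        rw [gen_zero, map_one])
      map_mul' := fun u v => Circle.ext (by
        change φ (gen Set.univ (u.toAdd + v.toAdd)) = φ _ * φ _
        rw [gen_univ_add, map_mul]) }
  have h : Multiplicative.ofAdd ((m, n) : ℤ × ℤ) =
      Multiplicative.ofAdd ((1, 0) : ℤ × ℤ) ^ m * Multiplicative.ofAdd ((0, 1) : ℤ × ℤ) ^ n := by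
    rw [← ofAdd_zsmul, ← ofAdd_zsmul, ← ofAdd_add]
    simp
  have hF := congrArg F h
  rw [map_mul, map_zpow, map_zpow] at hF
  exact congrArg Subtype.val hF

/-- Continuous functions on the torus as convolution operators on the full lattice. -/
def convolution : C(Circle × Circle, ℂ) →⋆ₐ[ℂ] toeplitzAlgebra Set.univ :=
  ((gelfandStarTransform (toeplitzAlgebra Set.univ)).symm :
    C(WeakDual.characterSpace ℂ (toeplitzAlgebra Set.univ), ℂ) →⋆ₐ[ℂ]
      toeplitzAlgebra Set.univ).comp (characterPoint.compStarAlgHom' ℂ ℂ)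

theorem character_convolution (φ : WeakDual.characterSpace ℂ (toeplitzAlgebra Set.univ))
    (f : C(Circle × Circle, ℂ)) : φ (convolution f) = f (characterPoint φ) := by
  have h : gelfandStarTransform (toeplitzAlgebra Set.univ) (convolution f) =
      f.comp characterPoint :=
    (gelfandStarTransform (toeplitzAlgebra Set.univ)).apply_symm_apply _
  exact congrArg (fun g : C(WeakDual.characterSpace ℂ (toeplitzAlgebra Set.univ), ℂ) => g φ) h

theorem convolution_monomial (m n : ℤ) : convolution (monomial m n) = gen Set.univ (m, n) := by
  refine (gelfandStarTransform (toeplitzAlgebra Set.univ)).injective ?_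
  ext φ
  exact (character_convolution φ _).trans (character_gen φ m n).symm

/-! ## Gauge action and symbols -/

theorem norm_monomial_apply (m n : ℤ) (z : Circle × Circle) : ‖monomial m n z‖ = 1 := by
  rw [monomial_apply, Circle.norm_coe]

theorem memlp_gauge (z : Circle × Circle) (φ : lp (fun _ : ℤ × ℤ => ℂ) 2) :
    Memℓp (fun p : ℤ × ℤ => monomial p.1 p.2 z * φ p) 2 := by
  have h := lp.memℓp φ
  rw [memℓp_gen_iff (by norm_num)] at h ⊢
  simpa only [norm_mul, norm_monomial_apply, one_mul] using h

/-- The diagonal operator that multiplies the basis vector at `p` by the value of the monomial of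
exponent `p` at `z`. -/
def gauge (z : Circle × Circle) : LatticeSpace →L[ℂ] LatticeSpace :=
  LinearMap.mkContinuous
    (show lp (fun _ : ℤ × ℤ => ℂ) 2 →ₗ[ℂ] lp (fun _ : ℤ × ℤ => ℂ) 2 from
    { toFun := fun φ => ⟨fun p => monomial p.1 p.2 z * φ p, memlp_gauge z φ⟩
      map_add' := fun _ _ => Subtype.ext (funext fun _ => mul_add _ _ _)
      map_smul' := fun _ _ => Subtype.ext (funext fun _ => mul_left_comm _ _ _) }) 1
    (fun φ : lp (fun _ : ℤ × ℤ => ℂ) 2 => by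
      rw [one_mul]
      refine (lp.norm_eq_tsum_rpow (by norm_num) _).trans_le
        (le_of_eq (Eq.trans ?_ (lp.norm_eq_tsum_rpow (by norm_num) φ).symm))
      refine congrArg (· ^ (1 / (2 : ℝ≥0∞).toReal)) (tsum_congr fun p => ?_)
      change ‖monomial p.1 p.2 z * φ p‖ ^ _ = _
      rw [norm_mul, norm_monomial_apply, one_mul])

theorem gauge_basisVec (z : Circle × Circle) (p : ℤ × ℤ) :
    gauge z (basisVec p) = monomial p.1 p.2 z • basisVec p := by
  refine Subtype.ext (funext fun q => ?_)
  change monomial q.1 q.2 z * (basisVec p).1 q = monomial p.1 p.2 z * (basisVec p).1 q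
  rw [basisVec_apply]
  split_ifs with h
  · rw [h]
  · rw [mul_zero, mul_zero]

/-- The gauge operator on the Hilbert space of the full lattice. -/
def gaugeUniv (z : Circle × Circle) : SubHilbert Set.univ →L[ℂ] SubHilbert Set.univ :=
  proj Set.univ ∘L gauge z ∘L incl Set.univ

theorem gaugeUniv_ket (z : Circle × Circle) (p : ℤ × ℤ) :
    gaugeUniv z (ket Set.univ p) = monomial p.1 p.2 z • ket Set.univ p := by
  simp only [gaugeUniv, ContinuousLinearMap.comp_apply, incl_ket (Set.mem_univ p), gauge_basisVec,
    map_smul]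
  rfl

/-- Rotation of functions on the torus. -/
def rotate (z : Circle × Circle) : C(Circle × Circle, ℂ) →⋆ₐ[ℂ] C(Circle × Circle, ℂ) :=
  ContinuousMap.compStarAlgHom' ℂ ℂ (ContinuousMap.mulLeft z)

theorem rotate_apply (z w : Circle × Circle) (f : C(Circle × Circle, ℂ)) :
    rotate z f w = f (z * w) := rfl

theorem rotate_monomial (z : Circle × Circle) (m n : ℤ) :
    rotate z (monomial m n) = monomial m n z • monomial m n := by
  ext w
  rw [rotate_apply, ContinuousMap.smul_apply, monomial_apply, monomial_apply, monomial_apply,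
    smul_eq_mul, ← Circle.coe_mul, Prod.fst_mul, Prod.snd_mul, mul_zpow, mul_zpow,
    mul_mul_mul_comm]

/-- The gauge operators implement rotation of the symbol. Both sides are linear and continuous in
`f`, so monomials suffice. -/
theorem gaugeUniv_comp_convolution (z : Circle × Circle) (f : C(Circle × Circle, ℂ)) :
    gaugeUniv z ∘L (convolution f).1 = (convolution (rotate z f)).1 ∘L gaugeUniv z := by
  have hc : Continuous fun f => (convolution f).1 :=
    continuous_subtype_val.comp (continuous_starAlgHom convolution)
  let Φ : C(Circle × Circle, ℂ) →ₗ[ℂ] (SubHilbert Set.univ →L[ℂ] SubHilbert Set.univ) :=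
    ((toeplitzAlgebra Set.univ).subtype.comp convolution).toAlgHom.toLinearMap
  refine mem_of_monomial_mem
    (LinearMap.eqLocus (LinearMap.mulLeft ℂ (gaugeUniv z) ∘ₗ Φ)
      (LinearMap.mulRight ℂ (gaugeUniv z) ∘ₗ Φ ∘ₗ (rotate z).toAlgHom.toLinearMap))
    (isClosed_eq (hc.const_mul (gaugeUniv z))
      ((hc.comp (continuous_starAlgHom (rotate z))).mul_const (gaugeUniv z))) (fun m n => ?_) f
  change gaugeUniv z ∘L (convolution (monomial m n)).1 =
    (convolution (rotate z (monomial m n))).1 ∘L gaugeUniv z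
  rw [rotate_monomial, map_smul, convolution_monomial]
  refine clm_ext fun p _ => ?_
  change gaugeUniv z ((gen Set.univ (m, n)).1 _) =
    monomial m n z • (gen Set.univ (m, n)).1 (gaugeUniv z _)
  rw [gaugeUniv_ket, map_smul, gen_univ_ket, gaugeUniv_ket, smul_smul]
  congr 1
  rw [← ContinuousMap.mul_apply, monomial_mul, add_comm m, add_comm n]
  rfl

/-- By gauge covariance the kernel is invariant under rotations. The algebra is nonzero, so it has a
character, and its torus point is a zero of every function in the kernel; rotating this one point to
an arbitrary `w` gives `f w = 0`. It is not necessary to know beforehand that every torus point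
comes from a character. -/
theorem convolution_injective : Function.Injective convolution := by
  rw [injective_iff_map_eq_zero]
  intro f hf
  have hrot : ∀ z, convolution (rotate z f) = 0 := by
    intro z
    refine Subtype.ext (clm_ext fun p _ => ?_)
    have h := congrArg (fun A => A (ket Set.univ p)) (gaugeUniv_comp_convolution z f)
    simp only [ContinuousLinearMap.comp_apply, hf, gaugeUniv_ket, map_smul] at h
    have h' : (0 : SubHilbert Set.univ) =
        monomial p.1 p.2 z • (convolution (rotate z f)).1 (ket Set.univ p) :=
      (map_zero (gaugeUniv z)).symm.trans h
    refine (smul_eq_zero.1 h'.symm).resolve_left fun h0 => ?_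
    have := norm_monomial_apply p.1 p.2 z
    rw [h0, norm_zero] at this
    exact zero_ne_one this
  have hne : Nontrivial (toeplitzAlgebra Set.univ) := by
    refine ⟨1, 0, fun h => ?_⟩
    have h1 : ket Set.univ 0 = 0 :=
      congrArg (fun A : toeplitzAlgebra Set.univ => A.1 (ket Set.univ 0)) h
    have h2 := inner_ket_ket 0 (Set.mem_univ (0 : ℤ × ℤ))
    rw [h1, inner_zero_left, if_pos rfl] at h2
    exact zero_ne_one h2
  obtain ⟨φ⟩ : Nonempty (WeakDual.characterSpace ℂ (toeplitzAlgebra Set.univ)) := inferInstance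
  ext w
  have h := character_convolution φ (rotate (w * (characterPoint φ)⁻¹) f)
  rw [hrot, map_zero, rotate_apply, inv_mul_cancel_right] at h
  exact h.symm

/-- An injective `*`-homomorphism of C*-algebras is isometric, so its range is closed; it contains
all words. -/
theorem convolution_bijective : Function.Bijective convolution := by
  refine ⟨convolution_injective, fun x => ?_⟩
  refine mem_of_word_mem convolution.toAlgHom.toLinearMap.range ?_ (fun l => ?_) x
  · exact (NonUnitalStarAlgHom.isometry convolution
      convolution_injective).isClosedEmbedding.isClosed_range
  · change word Set.univ l ∈ convolution.range
    refine list_prod_mem fun y hy => ?_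
    obtain ⟨v, -, rfl⟩ := List.mem_map.1 hy
    exact ⟨monomial v.1 v.2, convolution_monomial v.1 v.2⟩

/-- The symbol map of the Toeplitz algebra of the full lattice. -/
def symbolUniv : toeplitzAlgebra Set.univ →⋆ₐ[ℂ] C(Circle × Circle, ℂ) :=
  ((StarAlgEquiv.ofBijective convolution convolution_bijective).symm :
    toeplitzAlgebra Set.univ →⋆ₐ[ℂ] C(Circle × Circle, ℂ))

theorem symbolUniv_gen (v : ℤ × ℤ) : symbolUniv (gen Set.univ v) = monomial v.1 v.2 := by
  refine convolution_injective ?_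
  rw [convolution_monomial]
  exact (StarAlgEquiv.ofBijective convolution convolution_bijective).apply_symm_apply _

/-! ## Toeplitz operators with continuous symbols -/

/-- The bounded linear map `X ↦ A X B` between spaces of operators. -/
def sandwich {E F E' F' : Type*} [NormedAddCommGroup E] [NormedSpace ℂ E] [NormedAddCommGroup F]
    [NormedSpace ℂ F] [NormedAddCommGroup E'] [NormedSpace ℂ E'] [NormedAddCommGroup F']
    [NormedSpace ℂ F'] (A : F →L[ℂ] F') (B : E' →L[ℂ] E) : (E →L[ℂ] F) →L[ℂ] (E' →L[ℂ] F') :=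
  ContinuousLinearMap.compL ℂ E' F F' A ∘L (ContinuousLinearMap.compL ℂ E' E F).flip B

theorem sandwich_apply {E F E' F' : Type*} [NormedAddCommGroup E] [NormedSpace ℂ E]
    [NormedAddCommGroup F] [NormedSpace ℂ F] [NormedAddCommGroup E'] [NormedSpace ℂ E']
    [NormedAddCommGroup F'] [NormedSpace ℂ F'] (A : F →L[ℂ] F') (B : E' →L[ℂ] E) (X : E →L[ℂ] F)
    (x : E') : sandwich A B X x = A (X (B x)) := rfl

/-- Compression of convolution operators to `SubHilbert S`. -/
def compressedConvolution (S : Set (ℤ × ℤ)) :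
    C(Circle × Circle, ℂ) →ₗ[ℂ] (SubHilbert S →L[ℂ] SubHilbert S) :=
  (sandwich (transfer Set.univ S 0) (transfer S Set.univ 0)).toLinearMap ∘ₗ
    ((toeplitzAlgebra Set.univ).subtype.comp convolution).toAlgHom.toLinearMap

theorem continuous_compressedConvolution (S : Set (ℤ × ℤ)) :
    Continuous (compressedConvolution S) :=
  (sandwich (transfer Set.univ S 0) (transfer S Set.univ 0)).continuous.comp
    (continuous_subtype_val.comp (continuous_starAlgHom convolution))

theorem compressedConvolution_monomial (S : Set (ℤ × ℤ)) (m n : ℤ) :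
    compressedConvolution S (monomial m n) = (gen S (m, n)).1 := by
  refine clm_ext fun p hp => ?_
  change transfer Set.univ S 0 ((convolution (monomial m n)).1 (transfer S Set.univ 0 _)) = _
  rw [convolution_monomial, transfer_ket _ _ hp, gen_univ_ket, transfer_ket _ _ (Set.mem_univ _),
    add_zero, add_zero]
  exact (transfer_ket S _ hp).symm

theorem compressedConvolution_mem (S : Set (ℤ × ℤ)) (f : C(Circle × Circle, ℂ)) :
    compressedConvolution S f ∈ toeplitzAlgebra S := by
  refine mem_of_monomial_mem
    ((toeplitzAlgebra S).toSubalgebra.toSubmodule.comap (compressedConvolution S))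
    ((isClosed_toeplitzAlgebra S).preimage (continuous_compressedConvolution S)) (fun m n => ?_) f
  change compressedConvolution S (monomial m n) ∈ toeplitzAlgebra S
  rw [compressedConvolution_monomial]
  exact (gen S (m, n)).2

/-- The Toeplitz operator over `S` with a given continuous symbol. -/
def toeplitz (S : Set (ℤ × ℤ)) : C(Circle × Circle, ℂ) →ₗ[ℂ] toeplitzAlgebra S where
  toFun f := ⟨compressedConvolution S f, compressedConvolution_mem S f⟩
  map_add' _ _ := Subtype.ext (map_add _ _ _)
  map_smul' _ _ := Subtype.ext (map_smul _ _ _)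

theorem continuous_toeplitz (S : Set (ℤ × ℤ)) : Continuous (toeplitz S) :=
  (continuous_compressedConvolution S).subtype_mk _

theorem toeplitz_monomial (S : Set (ℤ × ℤ)) (m n : ℤ) : toeplitz S (monomial m n) = gen S (m, n) :=
  Subtype.ext (compressedConvolution_monomial S m n)

theorem apply_toeplitz {S R : Set (ℤ × ℤ)} (φ : toeplitzAlgebra S →⋆ₐ[ℂ] toeplitzAlgebra R)
    (hφ : ∀ v, φ (gen S v) = gen R v) (f : C(Circle × Circle, ℂ)) :
    φ (toeplitz S f) = toeplitz R f := by
  refine mem_of_monomial_mem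
    (LinearMap.eqLocus (φ.toAlgHom.toLinearMap ∘ₗ toeplitz S) (toeplitz R))
    (isClosed_eq ((continuous_starAlgHom φ).comp (continuous_toeplitz S)) (continuous_toeplitz R))
    (fun m n => ?_) f
  change φ (toeplitz S (monomial m n)) = toeplitz R (monomial m n)
  rw [toeplitz_monomial, toeplitz_monomial, hφ]

/-- `toeplitz S` is a continuous linear section of the symbol, though not multiplicative in general.
It gives surjectivity of `σ` and splits an operator into a Toeplitz part and a defect. -/
theorem symbol_toeplitz {S : Set (ℤ × ℤ)} (σ : toeplitzAlgebra S →⋆ₐ[ℂ] C(Circle × Circle, ℂ))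
    (hσ : ∀ v, σ (gen S v) = monomial v.1 v.2) (f : C(Circle × Circle, ℂ)) :
    σ (toeplitz S f) = f := by
  refine mem_of_monomial_mem
    (LinearMap.eqLocus (σ.toAlgHom.toLinearMap ∘ₗ toeplitz S) LinearMap.id)
    (isClosed_eq ((continuous_starAlgHom σ).comp (continuous_toeplitz S)) continuous_id)
    (fun m n => ?_) f
  change σ (toeplitz S (monomial m n)) = monomial m n
  rw [toeplitz_monomial, hσ]

/-- If the translates `S - v k` exhaust the lattice, then the Toeplitz algebra over `S` has a
symbol map. -/
theorem exists_isSymbolMap {S : Set (ℤ × ℤ)} (v : ℕ → ℤ × ℤ)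
    (hv : ∀ p, ∀ᶠ k in Filter.atTop, p + v k ∈ S) :
    ∃ σ : toeplitzAlgebra S →⋆ₐ[ℂ] C(Circle × Circle, ℂ), IsSymbolMap σ := by
  obtain ⟨φ, hφ⟩ := exists_limitHom (S := S) (R := Set.univ) v fun p =>
    (hv p).mono fun k hk => ⟨fun _ => trivial, fun _ => hk⟩
  have h : ∀ v, symbolUniv.comp φ (gen S v) = monomial v.1 v.2 := fun v => by
    rw [StarAlgHom.comp_apply, hφ, symbolUniv_gen]
  exact ⟨symbolUniv.comp φ, fun f => ⟨toeplitz S f, symbol_toeplitz _ h f⟩, fun m n => h (m, n)⟩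

/-! ## Compact operators in Toeplitz algebras -/

/-- A closed space of operators on a Hilbert space that contains all operators of rank one contains
all compact operators. -/
theorem mem_of_isCompactOperator {E : Type*} [NormedAddCommGroup E] [InnerProductSpace ℂ E]
    [CompleteSpace E] (W : Submodule ℂ (E →L[ℂ] E)) (hW : IsClosed (W : Set (E →L[ℂ] E)))
    (h : ∀ x y, InnerProductSpace.rankOne ℂ x y ∈ W) {T : E →L[ℂ] E} (hT : IsCompactOperator T) :
    T ∈ W := by
  have hclosure : T ∈ closure (W : Set (E →L[ℂ] E)) := by
    rw [Metric.mem_closure_iff]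
    intro ε hε
    have htb : TotallyBounded ((T : E → E) '' Metric.closedBall (0 : E) 1) :=
      (IsCompactOperator.isCompact_closure_image_closedBall
        (f := ((T : E →L[ℂ] E) : E →ₗ[ℂ] E)) hT 1).totallyBounded.subset subset_closure
    obtain ⟨t, -, htf, hcov⟩ := Metric.finite_approx_of_totallyBounded htb (ε / 2) (by positivity)
    -- `t` is a finite `ε / 2`-net of the image of the unit ball. The projection onto its span picks
    -- nearest points, so it moves each `T x` with `‖x‖ = 1` by at most `ε / 2`.
    let V : Submodule ℂ E := Submodule.span ℂ t
    have hV : FiniteDimensional ℂ V := FiniteDimensional.span_of_finite ℂ htf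
    let e := stdOrthonormalBasis ℂ V
    have hPT : V.starProjection ∘L T =
        ∑ i, InnerProductSpace.rankOne ℂ (e i : E) (ContinuousLinearMap.adjoint T (e i : E)) := by
      ext x
      have h1 := congrArg (Subtype.val : V → E) (e.sum_repr (V.orthogonalProjectionOnto (T x)))
      rw [ContinuousLinearMap.comp_apply, Submodule.starProjection_apply, ← h1,
        sum_apply, Submodule.coe_sum]
      refine Finset.sum_congr rfl fun i _ => ?_
      rw [InnerProductSpace.rankOne_apply, ContinuousLinearMap.adjoint_inner_left, Submodule.coe_smul,
        OrthonormalBasis.repr_apply_apply, Submodule.inner_orthogonalProjectionOnto_eq_of_mem_left]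
    refine ⟨V.starProjection ∘L T, ?_, ?_⟩
    · rw [hPT]
      exact sum_mem fun i _ => h _ _
    · rw [dist_eq_norm]
      refine lt_of_le_of_lt (b := ε / 2) ?_ (by linarith)
      refine ContinuousLinearMap.opNorm_le_of_unit_norm (by positivity) fun x hx => ?_
      have hx' : T x ∈ (T : E → E) '' Metric.closedBall (0 : E) 1 :=
        ⟨x, by simp [hx], rfl⟩
      obtain ⟨y, hy, hxy⟩ : ∃ y ∈ t, T x ∈ Metric.ball y (ε / 2) := by
        simpa using hcov hx'
      rw [sub_apply, ContinuousLinearMap.comp_apply,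
        Submodule.starProjection_minimal]
      refine (ciInf_le ⟨0, ?_⟩ (⟨y, Submodule.subset_span hy⟩ : V)).trans ?_
      · rintro _ ⟨w, rfl⟩
        exact norm_nonneg _
      · rw [Metric.mem_ball, dist_eq_norm] at hxy
        exact hxy.le
  exact hW.closure_subset hclosure

/-- A closed space of operators that contains the matrix units contains all compact operators. -/
theorem mem_of_rankOne_ket_mem {S : Set (ℤ × ℤ)}
    (W : Submodule ℂ (SubHilbert S →L[ℂ] SubHilbert S))
    (hW : IsClosed (W : Set (SubHilbert S →L[ℂ] SubHilbert S)))
    (h : ∀ p ∈ S, ∀ q ∈ S, InnerProductSpace.rankOne ℂ (ket S p) (ket S q) ∈ W)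
    {T : SubHilbert S →L[ℂ] SubHilbert S} (hT : IsCompactOperator T) : T ∈ W := by
  refine mem_of_isCompactOperator W hW (fun x y => ?_) hT
  have h1 : ∀ q ∈ S, ∀ x, InnerProductSpace.rankOne ℂ x (ket S q) ∈ W := fun q hq x => by
    have hc : Continuous fun x : SubHilbert S =>
        (InnerProductSpace.rankOne ℂ x (ket S q) : SubHilbert S →L[ℂ] SubHilbert S) := by fun_prop
    have hcl : IsClosed {x : SubHilbert S | InnerProductSpace.rankOne ℂ x (ket S q) ∈ W} :=
      hW.preimage hc
    refine hcl.closure_subset_iff.2 (fun x hx => ?_) (dense_kets S x)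
    induction hx using Submodule.span_induction with
    | mem x hx =>
      obtain ⟨p, rfl⟩ := hx
      by_cases hp : p ∈ S
      · exact h p hp q hq
      · simp [ket_of_notMem hp]
    | zero => simp
    | add x y _ _ hx hy =>
      simpa only [Set.mem_ofPred_eq, map_add, add_apply] using add_mem hx hy
    | smul c x _ hx =>
      simpa only [Set.mem_ofPred_eq, map_smul, smul_apply] using
        W.smul_mem c hx
  have hc : Continuous fun y : SubHilbert S =>
      (InnerProductSpace.rankOne ℂ x y : SubHilbert S →L[ℂ] SubHilbert S) := by fun_prop
  have hcl : IsClosed {y : SubHilbert S | InnerProductSpace.rankOne ℂ x y ∈ W} := hW.preimage hc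
  refine hcl.closure_subset_iff.2 (fun y hy => ?_) (dense_kets S y)
  induction hy using Submodule.span_induction with
  | mem y hy =>
    obtain ⟨q, rfl⟩ := hy
    by_cases hq : q ∈ S
    · exact h1 q hq x
    · simp [ket_of_notMem hq]
  | zero => simp
  | add y z _ _ hy hz => simpa only [Set.mem_ofPred_eq, map_add] using add_mem hy hz
  | smul c y _ hy => simpa only [Set.mem_ofPred_eq, map_smulₛₗ] using W.smul_mem _ hy

/-- An operator that kills all but finitely many basis vectors is compact. -/
theorem isCompactOperator_of_finite {S : Set (ℤ × ℤ)} {T : SubHilbert S →L[ℂ] SubHilbert S}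
    {F : Set (ℤ × ℤ)} (hF : F.Finite) (h : ∀ p ∈ S, p ∉ F → T (ket S p) = 0) :
    IsCompactOperator T := by
  have hsum : T = ∑ p ∈ hF.toFinset, InnerProductSpace.rankOne ℂ (T (ket S p)) (ket S p) := by
    refine clm_ext fun q hq => ?_
    rw [sum_apply]
    by_cases hqF : q ∈ F
    · rw [Finset.sum_eq_single_of_mem q (hF.mem_toFinset.2 hqF)]
      · rw [InnerProductSpace.rankOne_apply, inner_ket_ket _ hq, if_pos rfl, one_smul]
      · intro p _ hpq
        rw [InnerProductSpace.rankOne_apply, inner_ket_ket _ hq, if_neg hpq, zero_smul]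
    · rw [h q hq hqF, eq_comm]
      refine Finset.sum_eq_zero fun p hp => ?_
      have hpq : p ≠ q := by
        rintro rfl
        exact hqF (hF.mem_toFinset.1 hp)
      rw [InnerProductSpace.rankOne_apply, inner_ket_ket _ hq, if_neg hpq, zero_smul]
  rw [hsum]
  refine sum_mem (S := compactOperators (SubHilbert S)) fun p _ => ?_
  change IsCompactOperator (InnerProductSpace.rankOne ℂ (T (ket S p)) (ket S p) :
    SubHilbert S →L[ℂ] SubHilbert S)
  rw [InnerProductSpace.rankOne_def']
  have hc : IsCompactOperator (ContinuousLinearMap.toSpanSingleton ℂ (T (ket S p))) :=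
    isCompactOperator_of_locallyCompactSpace_rng
      (ContinuousLinearMap.toSpanSingleton ℂ (T (ket S p)))
  exact hc.comp_clm _

/-! ## Diagonal projections -/

/-- The element `X` of the Toeplitz algebra acts as the coordinate projection onto `F`. -/
def IsDiag {S : Set (ℤ × ℤ)} (X : toeplitzAlgebra S) (F : Set (ℤ × ℤ)) : Prop :=
  ∀ p, (p ∈ F → X.1 (ket S p) = ket S p) ∧ (p ∉ F → X.1 (ket S p) = 0)

theorem IsDiag.mul {S F G : Set (ℤ × ℤ)} {X Y : toeplitzAlgebra S} (hX : IsDiag X F)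
    (hY : IsDiag Y G) : IsDiag (X * Y) (F ∩ G) := fun p => by
  change (_ → X.1 (Y.1 _) = _) ∧ (_ → X.1 (Y.1 _) = _)
  refine ⟨fun h => by rw [(hY p).1 h.2, (hX p).1 h.1], fun h => ?_⟩
  by_cases hG : p ∈ G
  · rw [(hY p).1 hG, (hX p).2 fun hF => h ⟨hF, hG⟩]
  · rw [(hY p).2 hG, map_zero]

theorem IsDiag.one_sub {S F : Set (ℤ × ℤ)} {X : toeplitzAlgebra S} (hX : IsDiag X F) :
    IsDiag (1 - X) Fᶜ := fun p => by
  change (_ → ket S p - X.1 _ = _) ∧ (_ → ket S p - X.1 _ = _)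
  exact ⟨fun h => by rw [(hX p).2 h, sub_zero],
    fun h => by rw [(hX p).1 (not_not.1 h), sub_self]⟩

theorem IsDiag.eq_zero {S F : Set (ℤ × ℤ)} {X : toeplitzAlgebra S} (hX : IsDiag X F)
    (hF : ∀ p ∈ S, p ∉ F) : X = 0 :=
  Subtype.ext (clm_ext fun p hp => by rw [(hX p).2 (hF p hp)]; rfl)

theorem IsDiag.eq_one {S F : Set (ℤ × ℤ)} {X : toeplitzAlgebra S} (hX : IsDiag X F)
    (hF : S ⊆ F) : X = 1 :=
  Subtype.ext (clm_ext fun p hp => (hX p).1 (hF hp))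

/-- Restricting the set to the lattice points of `S` does not change the projection. -/
theorem IsDiag.inter {S F : Set (ℤ × ℤ)} {X : toeplitzAlgebra S} (hX : IsDiag X F) :
    IsDiag X (S ∩ F) := fun p => by
  refine ⟨fun h => (hX p).1 h.2, fun h => ?_⟩
  by_cases hp : p ∈ S
  · exact (hX p).2 fun hF => h ⟨hp, hF⟩
  · rw [ket_of_notMem hp, map_zero]

theorem isDiag_gen_mul_gen_neg (S : Set (ℤ × ℤ)) (u : ℤ × ℤ) :
    IsDiag (gen S u * gen S (-u)) {p | p - u ∈ S} := fun p => by
  change (p - u ∈ S → transfer S S u (transfer S S (-u) _) = _) ∧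
    (p - u ∉ S → transfer S S u (transfer S S (-u) _) = _)
  by_cases hp : p ∈ S
  · rw [transfer_ket S _ hp, ← sub_eq_add_neg]
    exact ⟨fun h => by rw [transfer_ket S _ h, sub_add_cancel],
      fun h => by rw [ket_of_notMem h, map_zero]⟩
  · simp [ket_of_notMem hp]

/-- Conjugating by a generator translates diagonal projections. -/
theorem IsDiag.translate {S F : Set (ℤ × ℤ)} {X : toeplitzAlgebra S} (hX : IsDiag X F) (hF : F ⊆ S)
    (u : ℤ × ℤ) : IsDiag (gen S u * X * gen S (-u)) {p | p - u ∈ F} := fun p => by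
  change (p - u ∈ F → transfer S S u (X.1 (transfer S S (-u) _)) = _) ∧
    (p - u ∉ F → transfer S S u (X.1 (transfer S S (-u) _)) = _)
  by_cases hp : p ∈ S
  · rw [transfer_ket S _ hp, ← sub_eq_add_neg]
    exact ⟨fun h => by rw [(hX _).1 h, transfer_ket S _ (hF h), sub_add_cancel],
      fun h => by rw [(hX _).2 h, map_zero]⟩
  · simp [ket_of_notMem hp]

/-- If the kernel of a homomorphism contains a projection onto finitely many lattice points, then it
contains the projection onto a single one. -/
theorem exists_isDiag_singleton {S : Set (ℤ × ℤ)} {B : Type*} [CStarAlgebra B]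
    (χ : toeplitzAlgebra S →⋆ₐ[ℂ] B) (n : ℕ) : ∀ (F : Finset (ℤ × ℤ)) (X : toeplitzAlgebra S),
      F.card ≤ n → F.Nonempty → (F : Set (ℤ × ℤ)) ⊆ S → IsDiag X F → χ X = 0 →
      ∃ p ∈ S, ∃ Y : toeplitzAlgebra S, IsDiag Y {p} ∧ χ Y = 0 := by
  induction n with
  | zero =>
    intro F X hcard hne
    exact absurd (Finset.card_pos.2 hne) (by omega)
  | succ n ih =>
    intro F X hcard hne hFS hX hχ
    obtain ⟨p, hp⟩ := hne
    by_cases h : ∃ q ∈ F, q ≠ p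
    · obtain ⟨q, hq, hqp⟩ := h
      have hw : q - p ≠ 0 := sub_ne_zero.2 hqp
      -- Intersecting `F` with its translate by `q - p` keeps `q`, since `p ∈ F`, and loses some
      -- other point.
      have hdiag := hX.mul (hX.translate hFS (q - p))
      let G : Finset (ℤ × ℤ) := F.filter fun r => r - (q - p) ∈ F
      have hG : (F : Set (ℤ × ℤ)) ∩ {r | r - (q - p) ∈ (F : Set (ℤ × ℤ))} = (G : Set (ℤ × ℤ)) := by
        ext r
        simp [G]
      rw [hG] at hdiag
      have hGF : G ⊂ F := by
        -- A nonempty finite set is not invariant under a nonzero translation: the sum of its points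
        -- would change by `F.card` times the vector.
        refine (Finset.filter_subset _ _).ssubset_of_ne fun hGF => ?_
        have hmaps : ∀ r ∈ F, r - (q - p) ∈ F := fun r hr => by
          rw [← hGF] at hr
          exact (Finset.mem_filter.1 hr).2
        have himage : F.image (· - (q - p)) = F :=
          Finset.eq_of_subset_of_card_le (Finset.image_subset_iff.2 hmaps)
            (Finset.card_image_of_injective F (sub_left_injective (b := q - p))).ge
        have hsum : ∑ r ∈ F, (r - (q - p)) = ∑ r ∈ F, r := by
          calc ∑ r ∈ F, (r - (q - p)) = ∑ r ∈ F.image (· - (q - p)), r := by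
                rw [Finset.sum_image fun x _ y _ hxy => sub_left_injective (b := q - p) hxy]
            _ = ∑ r ∈ F, r := by rw [himage]
        rw [Finset.sum_sub_distrib, sub_eq_self, Finset.sum_const] at hsum
        exact (smul_ne_zero (Finset.card_pos.2 ⟨p, hp⟩).ne' hw) hsum
      refine ih G _ ?_ ⟨q, ?_⟩ (fun r hr => hFS (hGF.1 hr)) hdiag ?_
      · have := Finset.card_lt_card hGF
        omega
      · simp [G, hp, hq]
      · rw [map_mul, hχ, zero_mul]
    · push Not at h
      have hF : (F : Set (ℤ × ℤ)) = {p} := by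
        ext r
        exact ⟨fun hr => h r hr, fun hr => hr ▸ hp⟩
      exact ⟨p, hFS hp, X, hF ▸ hX, hχ⟩

/-- If the kernel of a homomorphism contains a projection onto finitely many lattice points, then it
contains the compact operators. -/
theorem exists_eq_of_isCompactOperator {S : Set (ℤ × ℤ)} {B : Type*} [CStarAlgebra B]
    (χ : toeplitzAlgebra S →⋆ₐ[ℂ] B) {F : Set (ℤ × ℤ)} (hF : F.Finite) (hne : F.Nonempty)
    (hFS : F ⊆ S) {X : toeplitzAlgebra S} (hX : IsDiag X F) (hχ : χ X = 0)
    {T : SubHilbert S →L[ℂ] SubHilbert S} (hT : IsCompactOperator T) :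
    ∃ Y : toeplitzAlgebra S, Y.1 = T ∧ χ Y = 0 := by
  obtain ⟨p₀, hp₀, E, hE, hχE⟩ := exists_isDiag_singleton χ _ hF.toFinset X le_rfl
    (by simpa using hne) (by simpa using hFS) (by simpa using hX) hχ
  let W : Submodule ℂ (SubHilbert S →L[ℂ] SubHilbert S) :=
    (LinearMap.ker χ.toAlgHom.toLinearMap).map (toeplitzAlgebra S).subtype.toAlgHom.toLinearMap
  have hW : IsClosed (W : Set (SubHilbert S →L[ℂ] SubHilbert S)) :=
    (isClosed_toeplitzAlgebra S).isClosedEmbedding_subtypeVal.isClosedMap _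
      (isClosed_eq (continuous_starAlgHom χ) continuous_const)
  have hTW : T ∈ W := by
    refine mem_of_rankOne_ket_mem W hW (fun p hp q hq => ?_) hT
    -- Shift `q` to `p₀`, project onto `p₀`, shift `p₀` to `p`: the matrix unit, in the kernel
    -- because its middle factor is.
    refine ⟨gen S (p - p₀) * E * gen S (p₀ - q), ?_, clm_ext fun r hr => ?_⟩
    · change χ _ = 0
      rw [map_mul, map_mul, hχE, mul_zero, zero_mul]
    · change transfer S S _ (E.1 (transfer S S _ _)) = _
      rw [transfer_ket S _ hr, InnerProductSpace.rankOne_apply, inner_ket_ket _ hr]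
      have h : r + (p₀ - q) ∈ ({p₀} : Set (ℤ × ℤ)) ↔ q = r := by
        rw [Set.mem_singleton_iff, add_comm, sub_add, sub_eq_self, sub_eq_zero]
      by_cases hqr : q = r
      · rw [if_pos hqr, (hE _).1 (h.2 hqr), h.2 hqr, transfer_ket S _ hp₀, add_sub_cancel, one_smul]
      · rw [if_neg hqr, (hE _).2 (h.not.2 hqr), map_zero, zero_smul]
  obtain ⟨Y, hY, hYT⟩ := hTW
  exact ⟨Y, hYT, hY⟩

/-! ## Concave corners cut out by two linear functionals -/

/-- The half-plane on which a functional is nonnegative. -/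
def upper (a : ℤ × ℤ →+ ℝ) : Set (ℤ × ℤ) := {p | 0 ≤ a p}

/-- Two functionals on the lattice that cut out a corner: they are jointly proper, take all four
combinations of large signs, and the union of their half-planes looks like either of them far away
along the boundary. -/
structure IsCorner (a b : ℤ × ℤ →+ ℝ) : Prop where
  finite_box (N : ℝ) : {p | |a p| ≤ N ∧ |b p| ≤ N}.Finite
  exists_pos_pos (N : ℝ) : ∃ u, N ≤ a u ∧ N ≤ b u
  exists_pos_neg (N : ℝ) : ∃ u, N ≤ a u ∧ b u ≤ -N
  exists_neg_pos (N : ℝ) : ∃ u, a u ≤ -N ∧ N ≤ b u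
  exists_limit_left : ∃ v : ℕ → ℤ × ℤ, ∀ p, ∀ᶠ k in Filter.atTop,
    (0 ≤ a (p + v k) ∨ 0 ≤ b (p + v k) ↔ 0 ≤ a p)
  exists_limit_right : ∃ v : ℕ → ℤ × ℤ, ∀ p, ∀ᶠ k in Filter.atTop,
    (0 ≤ a (p + v k) ∨ 0 ≤ b (p + v k) ↔ 0 ≤ b p)

theorem IsCorner.symm {a b : ℤ × ℤ →+ ℝ} (h : IsCorner a b) : IsCorner b a where
  finite_box N := by simpa only [and_comm] using h.finite_box N
  exists_pos_pos N := by simpa only [and_comm] using h.exists_pos_pos N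
  exists_pos_neg N := by simpa only [and_comm] using h.exists_neg_pos N
  exists_neg_pos N := by simpa only [and_comm] using h.exists_pos_neg N
  exists_limit_left := by simpa only [or_comm] using h.exists_limit_right
  exists_limit_right := by simpa only [or_comm] using h.exists_limit_left

/-- Translating into the half-plane by vectors on which `a` tends to infinity exhausts the lattice.
-/
theorem exists_isSymbolMap_upper {a b : ℤ × ℤ →+ ℝ} (h : IsCorner a b) :
    ∃ σ : toeplitzAlgebra (upper a) →⋆ₐ[ℂ] C(Circle × Circle, ℂ), IsSymbolMap σ := by
  choose v hv using fun k : ℕ => h.exists_pos_pos k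
  refine exists_isSymbolMap v fun p => ?_
  obtain ⟨n, hn⟩ := exists_nat_ge (-a p)
  filter_upwards [Filter.eventually_ge_atTop n] with k hk
  have h1 : (n : ℝ) ≤ k := Nat.cast_le.2 hk
  have h2 := (hv k).1
  change 0 ≤ a (p + v k)
  rw [map_add]
  linarith

/-! ### The difference between a word and the generator with the same symbol -/

/-- The difference between a word and the generator with the same symbol. -/
def defectWord (S : Set (ℤ × ℤ)) (l : List (ℤ × ℤ)) : toeplitzAlgebra S := word S l - gen S l.sum

/-- The path described by a word that starts at `q` stays in `S`. -/
def Stays (S : Set (ℤ × ℤ)) (l : List (ℤ × ℤ)) (q : ℤ × ℤ) : Prop :=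
  ∀ t ∈ l.tails, q + t.sum ∈ S

theorem Stays.mem {S : Set (ℤ × ℤ)} {l : List (ℤ × ℤ)} {q : ℤ × ℤ} (h : Stays S l q) : q ∈ S := by
  simpa using h [] (by simp [List.mem_tails])

theorem defectWord_ket_of_stays {S : Set (ℤ × ℤ)} {l : List (ℤ × ℤ)} {q : ℤ × ℤ}
    (h : Stays S l q) : (defectWord S l).1 (ket S q) = 0 := by
  change (word S l).1 (ket S q) - transfer S S _ (ket S q) = 0
  rw [word_ket, if_pos (show ∀ t ∈ l.tails, q + t.sum ∈ S from h), transfer_ket S _ h.mem, sub_self]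

theorem defectWord_ket_of_not_stays {S : Set (ℤ × ℤ)} {l : List (ℤ × ℤ)} {q : ℤ × ℤ} (hq : q ∈ S)
    (h : ¬ Stays S l q) : (defectWord S l).1 (ket S q) = -ket S (q + l.sum) := by
  change (word S l).1 (ket S q) - transfer S S _ (ket S q) = _
  rw [word_ket, if_neg (show ¬ ∀ t ∈ l.tails, q + t.sum ∈ S from h), transfer_ket S _ hq, zero_sub]

theorem map_defectWord {S R : Set (ℤ × ℤ)} (φ : toeplitzAlgebra S →⋆ₐ[ℂ] toeplitzAlgebra R)
    (hφ : ∀ v, φ (gen S v) = gen R v) (l : List (ℤ × ℤ)) :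
    φ (defectWord S l) = defectWord R l := by
  rw [defectWord, map_sub, map_word φ hφ, hφ, defectWord]

/-- The operator minus the Toeplitz operator with the same symbol. -/
def defect {S : Set (ℤ × ℤ)} (σ : toeplitzAlgebra S →⋆ₐ[ℂ] C(Circle × Circle, ℂ)) :
    toeplitzAlgebra S →ₗ[ℂ] toeplitzAlgebra S :=
  LinearMap.id - toeplitz S ∘ₗ σ.toAlgHom.toLinearMap

theorem defect_apply {S : Set (ℤ × ℤ)} (σ : toeplitzAlgebra S →⋆ₐ[ℂ] C(Circle × Circle, ℂ))
    (x : toeplitzAlgebra S) : defect σ x = x - toeplitz S (σ x) := rfl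

theorem continuous_defect {S : Set (ℤ × ℤ)}
    (σ : toeplitzAlgebra S →⋆ₐ[ℂ] C(Circle × Circle, ℂ)) : Continuous (defect σ) :=
  continuous_id.sub ((continuous_toeplitz S).comp (continuous_starAlgHom σ))

theorem symbol_word {S : Set (ℤ × ℤ)} {σ : toeplitzAlgebra S →⋆ₐ[ℂ] C(Circle × Circle, ℂ)}
    (hσ : IsSymbolMap σ) (l : List (ℤ × ℤ)) : σ (word S l) = monomial l.sum.1 l.sum.2 := by
  induction l with
  | nil => exact (map_one σ).trans monomial_zero.symm
  | cons v l ih =>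
    have h : word S (v :: l) = gen S v * word S l := rfl
    rw [h, map_mul, ih, List.sum_cons, Prod.fst_add, Prod.snd_add, ← monomial_mul]
    exact congrArg (· * _) (hσ.2 v.1 v.2)

/-- The symbol of a word only sees its total displacement. Hence `defect σ` extends `defectWord`
continuously to the whole algebra. -/
theorem defect_word {S : Set (ℤ × ℤ)} {σ : toeplitzAlgebra S →⋆ₐ[ℂ] C(Circle × Circle, ℂ)}
    (hσ : IsSymbolMap σ) (l : List (ℤ × ℤ)) : defect σ (word S l) = defectWord S l := by
  rw [defect_apply, symbol_word hσ, toeplitz_monomial]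
  rfl

/-- `N` bounds how far a path can drift in either functional, hence the width of the boundary strip
where a word and its generator may differ. -/
theorem exists_tails_bound (a b : ℤ × ℤ →+ ℝ) (l : List (ℤ × ℤ)) :
    ∃ N : ℝ, 0 ≤ N ∧ ∀ t ∈ l.tails, |a t.sum| ≤ N ∧ |b t.sum| ≤ N := by
  obtain ⟨N, hN⟩ := (l.tails.finite_toSet.image fun t => max |a t.sum| |b t.sum|).bddAbove
  have h : ∀ t ∈ l.tails, max |a t.sum| |b t.sum| ≤ N := fun t ht => hN ⟨t, ht, rfl⟩
  refine ⟨N, ?_, fun t ht => max_le_iff.1 (h t ht)⟩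
  exact (abs_nonneg _).trans ((le_max_left _ _).trans (h l (by simp [List.mem_tails])))

/-! ### Cutting operators on a half-plane off at the corner -/

/-- The part of the half-plane of `a` where `b` is negative. -/
def wing (a b : ℤ × ℤ →+ ℝ) : Set (ℤ × ℤ) := {p | 0 ≤ a p ∧ b p < 0}

/-- Operators on the half-plane of `a`, cut down to the part of it where `b` is negative, as
operators on `SubHilbert S`. -/
def cut (a b : ℤ × ℤ →+ ℝ) (S : Set (ℤ × ℤ)) :
    (SubHilbert (upper a) →L[ℂ] SubHilbert (upper a)) →L[ℂ] (SubHilbert S →L[ℂ] SubHilbert S) :=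
  -- With shift `0` a transfer only restricts to a smaller set or extends by zero, so arguments and
  -- values are both truncated to the wing.
  sandwich (transfer (wing a b) S 0 ∘L transfer (upper a) (wing a b) 0)
    (transfer (wing a b) (upper a) 0 ∘L transfer S (wing a b) 0)

theorem cut_ket_of_notMem (a b : ℤ × ℤ →+ ℝ) {S : Set (ℤ × ℤ)}
    (X : SubHilbert (upper a) →L[ℂ] SubHilbert (upper a)) {q : ℤ × ℤ} (hq : q ∈ S)
    (h : q ∉ wing a b) : cut a b S X (ket S q) = 0 := by
  rw [cut, sandwich_apply, ContinuousLinearMap.comp_apply, ContinuousLinearMap.comp_apply,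
    transfer_ket _ _ hq, add_zero, ket_of_notMem h, map_zero, map_zero, map_zero, map_zero]

theorem cut_ket_of_apply_eq_zero {a b : ℤ × ℤ →+ ℝ} {S : Set (ℤ × ℤ)}
    {X : SubHilbert (upper a) →L[ℂ] SubHilbert (upper a)} {q : ℤ × ℤ} (hq : q ∈ S)
    (h : X (ket (upper a) q) = 0) : cut a b S X (ket S q) = 0 := by
  by_cases hw : q ∈ wing a b
  · rw [cut, sandwich_apply, ContinuousLinearMap.comp_apply, ContinuousLinearMap.comp_apply,
      transfer_ket _ _ hq, add_zero, transfer_ket _ _ hw, add_zero, h, map_zero, map_zero]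
  · exact cut_ket_of_notMem a b X hq hw

theorem cut_ket_of_apply_eq {a b : ℤ × ℤ →+ ℝ} {S : Set (ℤ × ℤ)}
    (hS : ∀ p, p ∈ S ↔ 0 ≤ a p ∨ 0 ≤ b p)
    {X : SubHilbert (upper a) →L[ℂ] SubHilbert (upper a)} {q r : ℤ × ℤ} (hq : q ∈ wing a b)
    (hr : b r < 0) (h : X (ket (upper a) q) = -ket (upper a) r) :
    cut a b S X (ket S q) = -ket S r := by
  rw [cut, sandwich_apply, ContinuousLinearMap.comp_apply, ContinuousLinearMap.comp_apply,
    transfer_ket _ _ ((hS q).2 (Or.inl hq.1)), add_zero, transfer_ket _ _ hq, add_zero, h, map_neg,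
    map_neg, neg_inj]
  by_cases har : 0 ≤ a r
  · have hra : r ∈ upper a := har
    have hrw : r ∈ wing a b := ⟨har, hr⟩
    rw [transfer_ket _ _ hra, add_zero, transfer_ket _ _ hrw, add_zero]
  -- Here `r` lies outside both half-planes, so both sides vanish.
  · have hra : r ∉ upper a := har
    have hrS : r ∉ S := fun h => ((hS r).1 h).elim har hr.not_ge
    rw [ket_of_notMem hra, map_zero, map_zero, ket_of_notMem hrS]

theorem stays_upper {a : ℤ × ℤ →+ ℝ} {l : List (ℤ × ℤ)} {N : ℝ}
    (hN : ∀ t ∈ l.tails, |a t.sum| ≤ N) {q : ℤ × ℤ} (hq : N ≤ a q) : Stays (upper a) l q :=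
  fun t ht => by
    change 0 ≤ a (q + t.sum)
    rw [map_add]
    linarith [neg_le_of_abs_le (hN t ht)]

theorem Stays.mono {R S : Set (ℤ × ℤ)} (hRS : R ⊆ S) {l : List (ℤ × ℤ)} {q : ℤ × ℤ}
    (h : Stays R l q) : Stays S l q := fun t ht => hRS (h t ht)

theorem self_mem_tails (l : List (ℤ × ℤ)) : l ∈ l.tails := by simp [List.mem_tails]

/-- Far away along the boundary of the half-plane of `a`, the operator given by a word on the
corner agrees with the one on the half-plane. -/
theorem defectWord_ket_eq_cut {a b : ℤ × ℤ →+ ℝ} {S : Set (ℤ × ℤ)}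
    (hS : ∀ p, p ∈ S ↔ 0 ≤ a p ∨ 0 ≤ b p) {l : List (ℤ × ℤ)} {N : ℝ}
    (hN : ∀ t ∈ l.tails, |b t.sum| ≤ N) {q : ℤ × ℤ} (hq : q ∈ S) (hbq : b q < -N) :
    (defectWord S l).1 (ket S q) = cut a b S (defectWord (upper a) l).1 (ket S q) := by
  -- The whole path has `b` negative, and there membership in `S` and in `upper a` coincide.
  have hb : ∀ t ∈ l.tails, b (q + t.sum) < 0 := fun t ht => by
    rw [map_add]
    linarith [le_of_abs_le (hN t ht)]
  by_cases h : Stays (upper a) l q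
  · rw [defectWord_ket_of_stays (h.mono fun p hp => (hS p).2 (Or.inl hp)),
      cut_ket_of_apply_eq_zero hq (defectWord_ket_of_stays h)]
  · have hbq' : b q < 0 := by simpa using hb [] (by simp [List.mem_tails])
    have hqa : q ∈ upper a := ((hS q).1 hq).resolve_right hbq'.not_ge
    have h' : ¬ Stays S l q := fun h' =>
      h fun t ht => ((hS _).1 (h' t ht)).resolve_right (hb t ht).not_ge
    rw [defectWord_ket_of_not_stays hq h', cut_ket_of_apply_eq hS ⟨hqa, hbq'⟩
      (hb l (self_mem_tails l)) (defectWord_ket_of_not_stays hqa h)]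

/-- On the corner, a word is, up to compact operators, determined by its symbol and the words on the
two half-planes. -/
theorem isCompactOperator_defectWord_sub {a b : ℤ × ℤ →+ ℝ} (hab : IsCorner a b)
    {S : Set (ℤ × ℤ)} (hS : ∀ p, p ∈ S ↔ 0 ≤ a p ∨ 0 ≤ b p) (l : List (ℤ × ℤ)) :
    IsCompactOperator ((defectWord S l).1 - cut a b S (defectWord (upper a) l).1 -
      cut b a S (defectWord (upper b) l).1) := by
  have hS' : ∀ p, p ∈ S ↔ 0 ≤ b p ∨ 0 ≤ a p := fun p => (hS p).trans or_comm
  obtain ⟨N, hN0, hN⟩ := exists_tails_bound a b l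
  have ha : ∀ t ∈ l.tails, |a t.sum| ≤ N := fun t ht => (hN t ht).1
  have hb : ∀ t ∈ l.tails, |b t.sum| ≤ N := fun t ht => (hN t ht).2
  -- Outside the box either one functional is below `-N`, and only the boundary of the other
  -- half-plane is felt, or one exceeds `N`, and the path stays in a half-plane so that all three
  -- terms vanish.
  refine isCompactOperator_of_finite (hab.finite_box N) fun q hq hbox => ?_
  rw [sub_apply, sub_apply]
  rcases lt_or_ge (a q) (-N) with h1 | h1
  · rw [defectWord_ket_eq_cut hS' ha hq h1, cut_ket_of_notMem a b _ hq, sub_zero, sub_self]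
    exact fun h => by linarith [h.1]
  rcases lt_or_ge (b q) (-N) with h2 | h2
  · rw [defectWord_ket_eq_cut hS hb hq h2, cut_ket_of_notMem b a _ hq, sub_zero, sub_self]
    exact fun h => by linarith [h.1]
  have h3 : N < a q ∨ N < b q := by
    by_contra! h
    exact hbox ⟨abs_le.2 ⟨h1, h.1⟩, abs_le.2 ⟨h2, h.2⟩⟩
  rcases h3 with h3 | h3
  · have h4 : Stays (upper a) l q := stays_upper ha h3.le
    rw [defectWord_ket_of_stays (h4.mono fun p hp => (hS p).2 (Or.inl hp)),
      cut_ket_of_apply_eq_zero hq (defectWord_ket_of_stays h4), cut_ket_of_notMem b a _ hq,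
      sub_zero, sub_zero]
    exact fun h => by linarith [h.2]
  · have h4 : Stays (upper b) l q := stays_upper hb h3.le
    rw [defectWord_ket_of_stays (h4.mono fun p hp => (hS p).2 (Or.inr hp)),
      cut_ket_of_apply_eq_zero hq (defectWord_ket_of_stays h4), cut_ket_of_notMem a b _ hq,
      sub_zero, sub_zero]
    exact fun h => by linarith [h.2]

/-- The word on the half-plane of `a`, cut off at the corner, is up to compact operators the word on
the corner restricted to a translate of the corner. -/
theorem isCompactOperator_mul_defectWord_sub {a b : ℤ × ℤ →+ ℝ} (hab : IsCorner a b)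
    {S : Set (ℤ × ℤ)} (hS : ∀ p, p ∈ S ↔ 0 ≤ a p ∨ 0 ≤ b p) {l : List (ℤ × ℤ)} {N : ℝ}
    (hN0 : 0 ≤ N) (hN : ∀ t ∈ l.tails, |a t.sum| ≤ N ∧ |b t.sum| ≤ N) {u : ℤ × ℤ} (hau : a u ≤ 0)
    (hbu : 2 * N ≤ b u) :
    IsCompactOperator ((gen S u * gen S (-u) * defectWord S l).1 -
      cut a b S (defectWord (upper a) l).1) := by
  have ha : ∀ t ∈ l.tails, |a t.sum| ≤ N := fun t ht => (hN t ht).1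
  have hb : ∀ t ∈ l.tails, |b t.sum| ≤ N := fun t ht => (hN t ht).2
  have hdiag := isDiag_gen_mul_gen_neg S u
  have hmul : ∀ x, (gen S u * gen S (-u) * defectWord S l).1 x =
    (gen S u * gen S (-u)).1 ((defectWord S l).1 x) := fun _ => rfl
  -- The extra `|a u|` ensures that `a` is still negative after subtracting `u` when `a q` is below
  -- the box.
  refine isCompactOperator_of_finite (hab.finite_box (N + |a u|)) fun q hq hbox => ?_
  rw [sub_apply, hmul]
  have hau' := abs_nonneg (a u)
  have hau'' := neg_abs_le (a u)
  have hal := abs_le.1 (ha l (self_mem_tails l))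
  have hbl := abs_le.1 (hb l (self_mem_tails l))
  rcases lt_or_ge (b q) (-(N + |a u|)) with h2 | h2
  · have h3 := defectWord_ket_eq_cut hS hb hq (by linarith)
    rw [← h3]
    by_cases h : Stays S l q
    · rw [defectWord_ket_of_stays h, map_zero, sub_zero]
    · rw [defectWord_ket_of_not_stays hq h, map_neg]
      by_cases hqS : q + l.sum ∈ S
      -- Since `a u ≤ 0`, subtracting `u` does not lead out of `upper a`, and the projection fixes
      -- the vector.
      · rw [(hdiag _).1, sub_self]
        refine (hS _).2 (Or.inl ?_)
        have h4 := ((hS _).1 hqS).resolve_right (by rw [map_add]; linarith)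
        rw [map_sub]
        linarith
      · rw [ket_of_notMem hqS, map_zero, sub_self]
  rcases lt_or_ge (a q) (-(N + |a u|)) with h1 | h1
  · rw [cut_ket_of_notMem a b _ hq fun h => by linarith [h.1], sub_zero]
    by_cases h : Stays S l q
    · rw [defectWord_ket_of_stays h, map_zero]
    -- To survive the projection the endpoint needs `b ≥ b u ≥ 2 * N`. Then `b q ≥ N`, and the path
    -- would have stayed in `upper b`.
    · rw [defectWord_ket_of_not_stays hq h, map_neg, (hdiag _).2, neg_zero]
      intro h3
      refine h (Stays.mono (R := upper b) (fun p hp => (hS p).2 (Or.inr hp)) (stays_upper hb ?_))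
      have h4 := ((hS _).1 h3).resolve_left (by rw [map_sub, map_add]; linarith)
      rw [map_sub, map_add] at h4
      linarith
  have h3 : N < a q ∨ N < b q := by
    by_contra! h
    exact hbox ⟨abs_le.2 ⟨h1, by linarith [h.1]⟩, abs_le.2 ⟨h2, by linarith [h.2]⟩⟩
  rcases h3 with h3 | h3
  · have h4 : Stays (upper a) l q := stays_upper ha h3.le
    rw [defectWord_ket_of_stays (h4.mono fun p hp => (hS p).2 (Or.inl hp)),
      cut_ket_of_apply_eq_zero hq (defectWord_ket_of_stays h4), map_zero, sub_zero]
  · have h4 : Stays (upper b) l q := stays_upper hb h3.le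
    rw [defectWord_ket_of_stays (h4.mono fun p hp => (hS p).2 (Or.inr hp)), map_zero,
      cut_ket_of_notMem a b _ hq fun h => by linarith [h.2], sub_zero]

/-! ### Exactness -/

/-- Every compact operator on the corner lies in the Toeplitz algebra and vanishes on both
half-planes. -/
theorem exists_eq_of_isCompactOperator_corner {a b : ℤ × ℤ →+ ℝ} (hab : IsCorner a b)
    {S : Set (ℤ × ℤ)} (hS : ∀ p, p ∈ S ↔ 0 ≤ a p ∨ 0 ≤ b p)
    {φ : toeplitzAlgebra S →⋆ₐ[ℂ] toeplitzAlgebra (upper a)}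
    (hφ : ∀ v, φ (gen S v) = gen (upper a) v)
    {ψ : toeplitzAlgebra S →⋆ₐ[ℂ] toeplitzAlgebra (upper b)}
    (hψ : ∀ v, ψ (gen S v) = gen (upper b) v) {T : SubHilbert S →L[ℂ] SubHilbert S}
    (hT : IsCompactOperator T) : ∃ Y : toeplitzAlgebra S, Y.1 = T ∧ φ Y = 0 ∧ ψ Y = 0 := by
  -- `X R` projects onto the points of `R` in `R + u` and `R + w` but not in `R + v`. On `upper a`
  -- there are none because `a u ≥ a v`, on `upper b` none because `b w ≥ b v`. On the corner the
  -- conditions force `a w ≤ a < a v` and `b u ≤ b < b v`, a bounded region containing `0`.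
  obtain ⟨v, hav, hbv⟩ := hab.exists_pos_pos 1
  obtain ⟨u, hau, hbu⟩ := hab.exists_pos_neg (a v)
  obtain ⟨w, haw, hbw⟩ := hab.exists_neg_pos (b v)
  let Q : ∀ R : Set (ℤ × ℤ), ℤ × ℤ → toeplitzAlgebra R := fun R u => gen R u * gen R (-u)
  let X : ∀ R : Set (ℤ × ℤ), toeplitzAlgebra R := fun R => (1 - Q R v) * (Q R u * Q R w)
  have hX : ∀ R, IsDiag (X R) ({p | p - v ∈ R}ᶜ ∩ ({p | p - u ∈ R} ∩ {p | p - w ∈ R})) := fun R =>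
    (isDiag_gen_mul_gen_neg R v).one_sub.mul
      ((isDiag_gen_mul_gen_neg R u).mul (isDiag_gen_mul_gen_neg R w))
  have hφX : φ (X S) = X (upper a) := by
    simp only [X, Q, map_mul, map_sub, map_one, hφ]
  have hψX : ψ (X S) = X (upper b) := by
    simp only [X, Q, map_mul, map_sub, map_one, hψ]
  have hφ0 : φ (X S) = 0 := by
    rw [hφX]
    refine (hX _).eq_zero fun p _ h => h.1 ?_
    have h1 : 0 ≤ a (p - u) := h.2.1
    change 0 ≤ a (p - v)
    rw [map_sub] at h1 ⊢
    linarith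
  have hψ0 : ψ (X S) = 0 := by
    rw [hψX]
    refine (hX _).eq_zero fun p _ h => h.1 ?_
    have h1 : 0 ≤ b (p - w) := h.2.2
    change 0 ≤ b (p - v)
    rw [map_sub] at h1 ⊢
    linarith
  let χ : toeplitzAlgebra S →⋆ₐ[ℂ] toeplitzAlgebra (upper a) × toeplitzAlgebra (upper b) :=
    φ.prod ψ
  have hmem0 : ∀ z : ℤ × ℤ, (0 - z ∈ S ↔ a z ≤ 0 ∨ b z ≤ 0) := fun z => by
    rw [hS, zero_sub, map_neg, map_neg, neg_nonneg, neg_nonneg]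
  let F : Set (ℤ × ℤ) := S ∩ ({p | p - v ∈ S}ᶜ ∩ ({p | p - u ∈ S} ∩ {p | p - w ∈ S}))
  have hfin : F.Finite := by
    refine (hab.finite_box (|a v| + |b v| + |a w| + |b u|)).subset ?_
    rintro p ⟨-, hpv, hpu, hpw⟩
    have h1 : ¬ (0 ≤ a (p - v) ∨ 0 ≤ b (p - v)) := (hS _).not.1 hpv
    have h2 := (hS _).1 hpu
    have h3 := (hS _).1 hpw
    simp only [map_sub, not_or, not_le, sub_nonneg] at h1 h2 h3
    have h4 := h2.resolve_left (by linarith)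
    have h5 := h3.resolve_right (by linarith)
    have := neg_abs_le (a w)
    have := neg_abs_le (b u)
    have := le_abs_self (a v)
    have := le_abs_self (b v)
    have := abs_nonneg (a v)
    have := abs_nonneg (b v)
    have := abs_nonneg (a w)
    have := abs_nonneg (b u)
    exact ⟨abs_le.2 ⟨by linarith, by linarith⟩, abs_le.2 ⟨by linarith, by linarith⟩⟩
  have hne : F.Nonempty := by
    refine ⟨0, (hS 0).2 (Or.inl (map_zero a).ge), ?_, ?_, ?_⟩
    · refine fun h => ?_
      rcases (hmem0 v).1 h with h | h <;> linarith
    · exact (hmem0 u).2 (Or.inr (by linarith))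
    · exact (hmem0 w).2 (Or.inl (by linarith))
  obtain ⟨Y, hYT, hY⟩ := exists_eq_of_isCompactOperator χ hfin hne Set.inter_subset_left
    (hX S).inter (Prod.ext hφ0 hψ0) hT
  exact ⟨Y, hYT, congrArg Prod.fst hY, congrArg Prod.snd hY⟩

/-- A word on the half-plane of `a`, minus the generator with the same symbol, lifts to the corner
together with zero on the other half-plane. -/
theorem exists_lift_defectWord {a b : ℤ × ℤ →+ ℝ} (hab : IsCorner a b)
    {S : Set (ℤ × ℤ)} (hS : ∀ p, p ∈ S ↔ 0 ≤ a p ∨ 0 ≤ b p)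
    {φ : toeplitzAlgebra S →⋆ₐ[ℂ] toeplitzAlgebra (upper a)}
    (hφ : ∀ v, φ (gen S v) = gen (upper a) v)
    {ψ : toeplitzAlgebra S →⋆ₐ[ℂ] toeplitzAlgebra (upper b)}
    (hψ : ∀ v, ψ (gen S v) = gen (upper b) v) (l : List (ℤ × ℤ)) :
    ∃ Y : toeplitzAlgebra S, Y.1 = cut a b S (defectWord (upper a) l).1 ∧
      φ Y = defectWord (upper a) l ∧ ψ Y = 0 := by
  obtain ⟨N, hN0, hN⟩ := exists_tails_bound a b l
  obtain ⟨u, hau, hbu⟩ := hab.exists_neg_pos (2 * N)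
  have hau0 : a u ≤ 0 := by linarith
  obtain ⟨K, hK, hφK, hψK⟩ := exists_eq_of_isCompactOperator_corner hab hS hφ hψ
    (isCompactOperator_mul_defectWord_sub hab hS hN0 hN hau0 hbu)
  refine ⟨gen S u * gen S (-u) * defectWord S l - K, ?_, ?_, ?_⟩
  · change (gen S u * gen S (-u) * defectWord S l).1 - K.1 = _
    rw [hK, sub_sub_cancel]
  · rw [map_sub, hφK, sub_zero, map_mul, map_mul, hφ, hφ, map_defectWord φ hφ]
    -- As `a u ≤ 0`, the translate `upper a + u` contains `upper a`.
    rw [(isDiag_gen_mul_gen_neg (upper a) u).eq_one, one_mul]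
    intro p hp
    have hp' : 0 ≤ a p := hp
    change 0 ≤ a (p - u)
    rw [map_sub]
    linarith
  · rw [map_sub, hψK, sub_zero, map_mul, map_mul, hψ, hψ, map_defectWord ψ hψ]
    refine Subtype.ext (clm_ext fun q hq => ?_)
    change (gen (upper b) u * gen (upper b) (-u)).1 ((defectWord (upper b) l).1 _) = 0
    by_cases h : Stays (upper b) l q
    · rw [defectWord_ket_of_stays h, map_zero]
    -- A path leaving `upper b` starts with `b < N`, so it ends with `b < 2 * N ≤ b u` and the
    -- projection kills the result.
    · rw [defectWord_ket_of_not_stays hq h, map_neg,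
        (isDiag_gen_mul_gen_neg (upper b) u _).2, neg_zero]
      intro h1
      have h2 : 0 ≤ b (q + l.sum - u) := h1
      rw [map_sub, map_add] at h2
      have hbl := abs_le.1 (hN l (self_mem_tails l)).2
      exact h (stays_upper (fun t ht => (hN t ht).2) (by linarith))

/-- An operator on the half-plane of `a`, minus the Toeplitz operator with the same symbol, lifts to
the corner together with zero on the other half-plane. -/
theorem exists_lift_defect {a b : ℤ × ℤ →+ ℝ} (hab : IsCorner a b)
    {S : Set (ℤ × ℤ)} (hS : ∀ p, p ∈ S ↔ 0 ≤ a p ∨ 0 ≤ b p)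
    {φ : toeplitzAlgebra S →⋆ₐ[ℂ] toeplitzAlgebra (upper a)}
    (hφ : ∀ v, φ (gen S v) = gen (upper a) v)
    {ψ : toeplitzAlgebra S →⋆ₐ[ℂ] toeplitzAlgebra (upper b)}
    (hψ : ∀ v, ψ (gen S v) = gen (upper b) v)
    {σ : toeplitzAlgebra (upper a) →⋆ₐ[ℂ] C(Circle × Circle, ℂ)} (hσ : IsSymbolMap σ)
    (A : toeplitzAlgebra (upper a)) : ∃ Y : toeplitzAlgebra S, φ Y = defect σ A ∧ ψ Y = 0 := by
  -- The lift is an explicit formula, linear and continuous in `A`, so what is known for words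
  -- passes to the closure.
  let C : toeplitzAlgebra (upper a) →ₗ[ℂ] (SubHilbert S →L[ℂ] SubHilbert S) :=
    (cut a b S).toLinearMap ∘ₗ (toeplitzAlgebra (upper a)).subtype.toAlgHom.toLinearMap ∘ₗ defect σ
  have hC : Continuous C :=
    (cut a b S).continuous.comp (continuous_subtype_val.comp (continuous_defect σ))
  have hCword : ∀ l, C (word (upper a) l) = cut a b S (defectWord (upper a) l).1 := fun l =>
    congrArg (fun X : toeplitzAlgebra (upper a) => cut a b S X.1) (defect_word hσ l)
  have hmem : ∀ A, C A ∈ toeplitzAlgebra S := by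
    refine mem_of_word_mem ((toeplitzAlgebra S).toSubalgebra.toSubmodule.comap C)
      ((isClosed_toeplitzAlgebra S).preimage hC) fun l => ?_
    obtain ⟨Y, hY, -⟩ := exists_lift_defectWord hab hS hφ hψ l
    change C (word (upper a) l) ∈ toeplitzAlgebra S
    rw [hCword, ← hY]
    exact Y.2
  let D : toeplitzAlgebra (upper a) →ₗ[ℂ] toeplitzAlgebra S :=
    { toFun := fun A => ⟨C A, hmem A⟩
      map_add' := fun _ _ => Subtype.ext (map_add C _ _)
      map_smul' := fun _ _ => Subtype.ext (map_smul C _ _) }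
  have hD : Continuous D := hC.subtype_mk _
  have hDword : ∀ l, φ (D (word (upper a) l)) = defect σ (word (upper a) l) ∧
      ψ (D (word (upper a) l)) = 0 := fun l => by
    obtain ⟨Y, hY, hφY, hψY⟩ := exists_lift_defectWord hab hS hφ hψ l
    have h : D (word (upper a) l) = Y := Subtype.ext ((hCword l).trans hY.symm)
    rw [h, hφY, hψY, defect_word hσ]
    exact ⟨rfl, rfl⟩
  refine ⟨D A, ?_, ?_⟩
  · exact mem_of_word_mem (LinearMap.eqLocus (φ.toAlgHom.toLinearMap ∘ₗ D) (defect σ))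
      (isClosed_eq ((continuous_starAlgHom φ).comp hD) (continuous_defect σ))
      (fun l => (hDword l).1) A
  · exact mem_of_word_mem (LinearMap.ker (ψ.toAlgHom.toLinearMap ∘ₗ D))
      (isClosed_eq ((continuous_starAlgHom ψ).comp hD) continuous_const)
      (fun l => (hDword l).2) A

/-- Pairs of operators on the two half-planes with the same symbol lift to the corner. -/
theorem exists_lift {a b : ℤ × ℤ →+ ℝ} (hab : IsCorner a b)
    {S : Set (ℤ × ℤ)} (hS : ∀ p, p ∈ S ↔ 0 ≤ a p ∨ 0 ≤ b p)
    {φ : toeplitzAlgebra S →⋆ₐ[ℂ] toeplitzAlgebra (upper a)}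
    (hφ : ∀ v, φ (gen S v) = gen (upper a) v)
    {ψ : toeplitzAlgebra S →⋆ₐ[ℂ] toeplitzAlgebra (upper b)}
    (hψ : ∀ v, ψ (gen S v) = gen (upper b) v)
    {σ : toeplitzAlgebra (upper a) →⋆ₐ[ℂ] C(Circle × Circle, ℂ)} (hσ : IsSymbolMap σ)
    {τ : toeplitzAlgebra (upper b) →⋆ₐ[ℂ] C(Circle × Circle, ℂ)} (hτ : IsSymbolMap τ)
    {A : toeplitzAlgebra (upper a)} {B : toeplitzAlgebra (upper b)} (hAB : σ A = τ B) :
    ∃ Y : toeplitzAlgebra S, φ Y = A ∧ ψ Y = B := by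
  obtain ⟨Y, hφY, hψY⟩ := exists_lift_defect hab hS hφ hψ hσ A
  obtain ⟨Z, hψZ, hφZ⟩ :=
    exists_lift_defect hab.symm (fun p => (hS p).trans or_comm) hψ hφ hτ B
  -- `Y` supplies the defect of `A` and is invisible to `ψ`; `Z` supplies the defect of `B` and is
  -- invisible to `φ`.
  refine ⟨toeplitz S (σ A) + Y + Z, ?_, ?_⟩
  · rw [map_add, map_add, apply_toeplitz φ hφ, hφY, hφZ, defect_apply, add_zero, add_sub_cancel]
  · rw [map_add, map_add, apply_toeplitz ψ hψ, hψY, hψZ, defect_apply, add_zero, hAB,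
      add_sub_cancel]

/-- An element of the Toeplitz algebra of the corner that vanishes on both half-planes is
compact. -/
theorem isCompactOperator_of_map_eq_zero {a b : ℤ × ℤ →+ ℝ} (hab : IsCorner a b)
    {S : Set (ℤ × ℤ)} (hS : ∀ p, p ∈ S ↔ 0 ≤ a p ∨ 0 ≤ b p)
    {φ : toeplitzAlgebra S →⋆ₐ[ℂ] toeplitzAlgebra (upper a)}
    (hφ : ∀ v, φ (gen S v) = gen (upper a) v)
    {ψ : toeplitzAlgebra S →⋆ₐ[ℂ] toeplitzAlgebra (upper b)}
    (hψ : ∀ v, ψ (gen S v) = gen (upper b) v)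
    {σ : toeplitzAlgebra (upper a) →⋆ₐ[ℂ] C(Circle × Circle, ℂ)} (hσ : IsSymbolMap σ)
    {τ : toeplitzAlgebra (upper b) →⋆ₐ[ℂ] C(Circle × Circle, ℂ)} (hτ : IsSymbolMap τ)
    {X : toeplitzAlgebra S} (hφX : φ X = 0) (hψX : ψ X = 0) : IsCompactOperator X.1 := by
  let val : ∀ R : Set (ℤ × ℤ), toeplitzAlgebra R →ₗ[ℂ] (SubHilbert R →L[ℂ] SubHilbert R) :=
    fun R => (toeplitzAlgebra R).subtype.toAlgHom.toLinearMap
  have hval : ∀ R, Continuous (val R) := fun R => continuous_subtype_val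
  have hsym : IsSymbolMap (σ.comp φ) :=
    ⟨fun f => ⟨toeplitz S f, by
      rw [StarAlgHom.comp_apply, apply_toeplitz φ hφ, symbol_toeplitz σ fun v => hσ.2 v.1 v.2]⟩,
      fun m n => (congrArg σ (hφ (m, n))).trans (hσ.2 m n)⟩
  -- `L` has compact values on words, hence everywhere, as the compacts are closed. On the common
  -- kernel of `φ` and `ψ` the symbol and both truncated defects vanish, so `L` is the identity
  -- there.
  let L : toeplitzAlgebra S →ₗ[ℂ] (SubHilbert S →L[ℂ] SubHilbert S) :=
    val S ∘ₗ defect (σ.comp φ) -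
      (cut a b S).toLinearMap ∘ₗ val (upper a) ∘ₗ defect σ ∘ₗ φ.toAlgHom.toLinearMap -
      (cut b a S).toLinearMap ∘ₗ val (upper b) ∘ₗ defect τ ∘ₗ ψ.toAlgHom.toLinearMap
  have hL : Continuous L :=
    (((hval S).comp (continuous_defect _)).sub ((cut a b S).continuous.comp ((hval (upper a)).comp
      ((continuous_defect σ).comp (continuous_starAlgHom φ))))).sub
      ((cut b a S).continuous.comp ((hval (upper b)).comp
        ((continuous_defect τ).comp (continuous_starAlgHom ψ))))
  have hLX : ∀ Y, IsCompactOperator (L Y) := by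
    refine mem_of_word_mem
      ((compactOperators (SubHilbert S)).toNonUnitalSubalgebra.toSubmodule.comap L)
      (isClosed_setOfPred_isCompactOperator.preimage hL) fun l => ?_
    have h : L (word S l) = (defectWord S l).1 - cut a b S (defectWord (upper a) l).1 -
        cut b a S (defectWord (upper b) l).1 := by
      change (defect (σ.comp φ) (word S l)).1 - cut a b S (defect σ (φ (word S l))).1 -
        cut b a S (defect τ (ψ (word S l))).1 = _
      rw [defect_word hsym, map_word φ hφ, map_word ψ hψ, defect_word hσ, defect_word hτ]
    change IsCompactOperator (L (word S l))
    rw [h]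
    exact isCompactOperator_defectWord_sub hab hS l
  have hX : L X = X.1 := by
    change (X - toeplitz S (σ (φ X))).1 - cut a b S (defect σ (φ X)).1 -
      cut b a S (defect τ (ψ X)).1 = _
    have hz : ∀ R : Set (ℤ × ℤ), (0 : toeplitzAlgebra R).1 = 0 := fun _ => rfl
    rw [hφX, hψX, map_zero, map_zero, map_zero, map_zero, hz, hz, map_zero, map_zero, sub_zero,
      sub_zero, sub_zero]
  exact hX ▸ hLX X

/-! ### Maps into a pullback and assembly of the sequence -/

section PairHom

variable {A B C D : Type*} [Semiring A] [StarRing A] [Algebra ℂ A] [Semiring B] [StarRing B]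
  [Algebra ℂ B] [Semiring C] [StarRing C] [Algebra ℂ C] [Semiring D] [StarRing D] [Algebra ℂ D]
  [StarModule ℂ A] [StarModule ℂ B] {σ : A →⋆ₐ[ℂ] C} {τ : B →⋆ₐ[ℂ] C}

/-- The homomorphism into a pullback given by a commutative square. -/
def pairHom (φ : D →⋆ₐ[ℂ] A) (ψ : D →⋆ₐ[ℂ] B) (h : ∀ x, σ (φ x) = τ (ψ x)) :
    D →⋆ₐ[ℂ] pullback σ τ :=
  (φ.prod ψ).codRestrict (pullback σ τ) h

theorem coe_pairHom (φ : D →⋆ₐ[ℂ] A) (ψ : D →⋆ₐ[ℂ] B) (h : ∀ x, σ (φ x) = τ (ψ x)) (x : D) :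
    (pairHom φ ψ h x).1 = (φ x, ψ x) := rfl

theorem pairHom_eq_zero_iff (φ : D →⋆ₐ[ℂ] A) (ψ : D →⋆ₐ[ℂ] B) (h : ∀ x, σ (φ x) = τ (ψ x))
    (x : D) : pairHom φ ψ h x = 0 ↔ φ x = 0 ∧ ψ x = 0 := by
  rw [Subtype.ext_iff, coe_pairHom]
  exact Prod.mk_eq_zero

theorem pairHom_surjective (φ : D →⋆ₐ[ℂ] A) (ψ : D →⋆ₐ[ℂ] B) (h : ∀ x, σ (φ x) = τ (ψ x))
    (hlift : ∀ a b, σ a = τ b → ∃ x, φ x = a ∧ ψ x = b) : Function.Surjective (pairHom φ ψ h) := by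
  rintro ⟨⟨a, b⟩, hab⟩
  obtain ⟨x, rfl, rfl⟩ := hlift a b hab
  exact ⟨x, rfl⟩

end PairHom

/-- The homomorphisms to the two half-planes make up a short exact sequence. -/
theorem exists_exact_sequence {a b : ℤ × ℤ →+ ℝ} (hab : IsCorner a b)
    {S : Set (ℤ × ℤ)} (hS : ∀ p, p ∈ S ↔ 0 ≤ a p ∨ 0 ≤ b p)
    {φ : toeplitzAlgebra S →⋆ₐ[ℂ] toeplitzAlgebra (upper a)}
    (hφ : ∀ v, φ (gen S v) = gen (upper a) v)
    {ψ : toeplitzAlgebra S →⋆ₐ[ℂ] toeplitzAlgebra (upper b)}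
    (hψ : ∀ v, ψ (gen S v) = gen (upper b) v)
    {σ : toeplitzAlgebra (upper a) →⋆ₐ[ℂ] C(Circle × Circle, ℂ)} (hσ : IsSymbolMap σ)
    {τ : toeplitzAlgebra (upper b) →⋆ₐ[ℂ] C(Circle × Circle, ℂ)} (hτ : IsSymbolMap τ) :
    ∃ (ι : compactOperators (SubHilbert S) →⋆ₙₐ[ℂ] toeplitzAlgebra S)
      (γ : toeplitzAlgebra S →⋆ₐ[ℂ] pullback σ τ),
      (∀ T, (ι T).1 = T.1) ∧
      (∀ m n : ℤ, (γ (toeplitzGen S m n)).1 =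
        (toeplitzGen (upper a) m n, toeplitzGen (upper b) m n)) ∧
      Function.Injective ι ∧ Function.Exact ι γ ∧ Function.Surjective γ := by
  have hsymbol : σ.comp φ = τ.comp ψ := starAlgHom_eq_of_gen fun u => by
    rw [StarAlgHom.comp_apply, StarAlgHom.comp_apply, hφ, hψ]
    exact (hσ.2 u.1 u.2).trans (hτ.2 u.1 u.2).symm
  have hpair : ∀ X, σ (φ X) = τ (ψ X) := fun X => DFunLike.congr_fun hsymbol X
  have hcompact : ∀ T : compactOperators (SubHilbert S),
      ∃ Y : toeplitzAlgebra S, Y.1 = T.1 ∧ φ Y = 0 ∧ ψ Y = 0 := fun T =>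
    exists_eq_of_isCompactOperator_corner hab hS hφ hψ T.2
  have hmem : ∀ T : compactOperators (SubHilbert S), T.1 ∈ toeplitzAlgebra S := fun T => by
    obtain ⟨Y, hY, -⟩ := hcompact T
    exact hY ▸ Y.2
  let ι : compactOperators (SubHilbert S) →⋆ₙₐ[ℂ] toeplitzAlgebra S :=
    { toFun := fun T => ⟨T.1, hmem T⟩
      map_smul' := fun _ _ => rfl
      map_zero' := rfl
      map_add' := fun _ _ => rfl
      map_mul' := fun _ _ => rfl
      map_star' := fun _ => rfl }
  have hι : ∀ T, (ι T).1 = T.1 := fun _ => rfl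
  have hinj : Function.Injective ι := fun T U h => by
    refine Subtype.ext ?_
    rw [← hι, ← hι, h]
  have hexact : Function.Exact ι (pairHom φ ψ hpair) := fun X => by
    refine (pairHom_eq_zero_iff φ ψ hpair X).trans ⟨?_, ?_⟩
    · rintro ⟨h1, h2⟩
      exact ⟨⟨X.1, isCompactOperator_of_map_eq_zero hab hS hφ hψ hσ hτ h1 h2⟩, Subtype.ext (hι _)⟩
    · rintro ⟨T, rfl⟩
      obtain ⟨Y, hY, hφY, hψY⟩ := hcompact T
      have h : ι T = Y := Subtype.ext ((hι T).trans hY.symm)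
      rw [h]
      exact ⟨hφY, hψY⟩
  have hsurj : Function.Surjective (pairHom φ ψ hpair) :=
    pairHom_surjective φ ψ _ fun _ _ h => exists_lift hab hS hφ hψ hσ hτ h
  refine ⟨ι, pairHom φ ψ hpair, hι, fun m n => ?_, hinj, hexact, hsurj⟩
  exact (coe_pairHom φ ψ _ _).trans (Prod.ext (hφ (m, n)) (hψ (m, n)))

theorem exists_limitHom_left {a b : ℤ × ℤ →+ ℝ} (hab : IsCorner a b)
    {S : Set (ℤ × ℤ)} (hS : ∀ p, p ∈ S ↔ 0 ≤ a p ∨ 0 ≤ b p) :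
    ∃ φ : toeplitzAlgebra S →⋆ₐ[ℂ] toeplitzAlgebra (upper a),
      ∀ v, φ (gen S v) = gen (upper a) v := by
  obtain ⟨v, hv⟩ := hab.exists_limit_left
  exact exists_limitHom v fun p => (hv p).mono fun k hk => (hS _).trans hk

theorem exists_limitHom_right {a b : ℤ × ℤ →+ ℝ} (hab : IsCorner a b)
    {S : Set (ℤ × ℤ)} (hS : ∀ p, p ∈ S ↔ 0 ≤ a p ∨ 0 ≤ b p) :
    ∃ ψ : toeplitzAlgebra S →⋆ₐ[ℂ] toeplitzAlgebra (upper b),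
      ∀ v, ψ (gen S v) = gen (upper b) v := by
  obtain ⟨v, hv⟩ := hab.exists_limit_right
  exact exists_limitHom v fun p => (hv p).mono fun k hk => (hS _).trans hk

theorem IsCorner.hasExactSequence {a b : ℤ × ℤ →+ ℝ} (hab : IsCorner a b)
    {S : Set (ℤ × ℤ)} (hS : ∀ p, p ∈ S ↔ 0 ≤ a p ∨ 0 ≤ b p) :
    HasExactSequence S (upper a) (upper b) :=
  Exists.elim (exists_isSymbolMap_upper hab) fun σ hσ =>
  Exists.elim (exists_isSymbolMap_upper hab.symm) fun τ hτ =>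
  Exists.elim (exists_limitHom_left hab hS) fun _ hφ =>
  Exists.elim (exists_limitHom_right hab hS) fun _ hψ =>
  ⟨σ, τ, hσ, hτ, exists_exact_sequence hab hS hφ hψ hσ hτ⟩

/-! ## Corners between lines of given slopes -/

/-- The functional `(x, y) ↦ c x + d y` on the lattice. -/
def functional (c d : ℝ) : ℤ × ℤ →+ ℝ where
  toFun p := c * p.1 + d * p.2
  map_zero' := by simp
  map_add' p q := by
    push_cast [Prod.fst_add, Prod.snd_add]
    ring

theorem functional_apply (c d : ℝ) (p : ℤ × ℤ) : functional c d p = c * p.1 + d * p.2 := rfl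

/-- The multiples of a real number come arbitrarily close to the integers from above. -/
theorem exists_int_add_mul_lt (ξ : ℝ) {ε : ℝ} (hε : 0 < ε) (N : ℝ) :
    ∃ x y : ℤ, N ≤ y ∧ 0 ≤ x + ξ * y ∧ x + ξ * y < ε := by
  obtain ⟨M, hM⟩ := exists_nat_ge (max N 1)
  have hMN : N ≤ M := (le_max_left _ _).trans hM
  have hM1 : (1 : ℝ) ≤ M := (le_max_right _ _).trans hM
  -- The bound by `1` guarantees `m ≥ 1` below when `d` is negative, which keeps `y ≥ N`.
  set δ := min ε 1 with hδ
  have hδ0 : 0 < δ := lt_min hε one_pos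
  obtain ⟨n, hn⟩ := exists_nat_gt (M / δ)
  have hn0 : 0 < n := by
    have : (0 : ℝ) < n := lt_of_le_of_lt (by positivity) hn
    exact_mod_cast this
  -- Dirichlet approximation; multiplying by `M` then makes `y` large while the error `d` stays
  -- below `δ`.
  obtain ⟨j, k, hk0, -, hjk⟩ := Real.exists_int_int_abs_mul_sub_le ξ hn0
  have hk1 : (1 : ℝ) ≤ k := by exact_mod_cast hk0
  set d := M * (k * ξ - j) with hd
  have hdδ : |d| < δ := by
    rw [hd, abs_mul, abs_of_nonneg (by linarith)]
    rw [div_lt_iff₀ hδ0] at hn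
    calc (M : ℝ) * |k * ξ - j| ≤ M * (1 / (n + 1)) := by gcongr
      _ = M / (n + 1) := by ring
      _ < δ := by
        rw [div_lt_iff₀ (by positivity)]
        nlinarith
  have hMk : (M : ℝ) ≤ M * k := le_mul_of_one_le_right (by linarith) hk1
  rcases le_or_gt 0 d with h0 | h0
  · refine ⟨-(M * j), M * k, ?_, ?_, ?_⟩
    · push_cast
      linarith
    · push_cast
      linarith
    · push_cast
      have := lt_of_le_of_lt (le_abs_self d) (hdδ.trans_le (min_le_left _ _))
      linarith
  · rw [abs_of_neg h0] at hdδ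
    -- An error of the wrong sign is added to `1` as often as the sum stays nonnegative, leaving a
    -- remainder in `[0, -d)`.
    set m := ⌊1 / -d⌋₊ with hm
    have hd0 : 0 < -d := by linarith
    have hm1 : (m : ℝ) * -d ≤ 1 := by
      rw [← le_div_iff₀ hd0]
      exact Nat.floor_le (by positivity)
    have hm2 : 1 < ((m : ℝ) + 1) * -d := by
      rw [← div_lt_iff₀ hd0]
      exact Nat.lt_floor_add_one _
    have hm3 : (1 : ℝ) ≤ m := by
      have : 1 ≤ m := Nat.le_floor (by
        rw [Nat.cast_one, le_div_iff₀ hd0]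
        linarith [min_le_right ε 1])
      exact_mod_cast this
    refine ⟨1 - m * (M * j), m * (M * k), ?_, ?_, ?_⟩
    · push_cast
      nlinarith
    · push_cast
      rw [hd] at hm1
      linarith
    · push_cast
      have := min_le_left ε 1
      have h4 : (1 : ℝ) - m * (M * j) + ξ * (m * (M * k)) = 1 - m * -d := by
        rw [hd]
        ring
      rw [h4]
      linarith

/-- Lattice points approach the line `c₁ x + d₁ y = 0` from its nonnegative side by Diophantine
approximation of its slope. On that line the second functional is `y` times the determinant over
`c₁`, hence unbounded; if `c₁ = 0`, horizontal vectors lie on the line itself. -/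
theorem exists_functional_lt {c₁ d₁ c₂ d₂ : ℝ} (hdet : c₁ * d₂ - d₁ * c₂ ≠ 0) {ε : ℝ} (hε : 0 < ε)
    (N : ℝ) : ∃ v, 0 ≤ functional c₁ d₁ v ∧ functional c₁ d₁ v < ε ∧ functional c₂ d₂ v ≤ -N := by
  simp only [functional_apply]
  have hsign : ∀ x : ℝ, ∃ s : ℤ, (s : ℝ) * s = 1 ∧ x * s = |x| := fun x => by
    rcases le_total 0 x with h | h
    · exact ⟨1, by simp, by simp [abs_of_nonneg h]⟩
    · exact ⟨-1, by simp, by simp [abs_of_nonpos h]⟩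
  by_cases hc : c₁ = 0
  · subst hc
    have hc2 : c₂ ≠ 0 := by
      rintro rfl
      simp at hdet
    obtain ⟨s, -, hs⟩ := hsign c₂
    obtain ⟨n, hn⟩ := exists_nat_ge (N / |c₂|)
    rw [div_le_iff₀ (abs_pos.2 hc2)] at hn
    refine ⟨(-(s * n), 0), by simp, by simpa using hε, ?_⟩
    push_cast
    have : c₂ * -(s * n) + d₂ * 0 = -(n * |c₂|) := by
      rw [← hs]
      ring
    rw [this]
    linarith
  · obtain ⟨s, hss, hs⟩ := hsign c₁
    set κ := (c₁ * d₂ - d₁ * c₂) / c₁ with hκ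
    have hκ0 : 0 < |κ| := abs_pos.2 (div_ne_zero hdet hc)
    obtain ⟨t, htt, ht⟩ := hsign (-κ)
    rw [abs_neg] at ht
    have hc0 : 0 < |c₁| := abs_pos.2 hc
    -- The signs `s`, `t` turn the first functional into `|c₁| * δ` and the second into `-|κ| * y`
    -- plus an error of at most `|c₂| * (ε / |c₁|)`, which the lower bound on `y` absorbs.
    obtain ⟨x, y, hy, h0, h1⟩ := exists_int_add_mul_lt (s * t * (d₁ / c₁))
      (ε := ε / |c₁|) (by positivity) ((N + |c₂| * (ε / |c₁|)) / |κ|)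
    set δ := (x : ℝ) + s * t * (d₁ / c₁) * y with hδ
    have ha : c₁ * (s * x) + d₁ * (t * y) = |c₁| * δ := by
      have : |c₁| * δ = c₁ * s * x + (s * s) * t * y * (c₁ * (d₁ / c₁)) := by
        rw [hδ, ← hs]
        ring
      rw [this, hss, mul_div_cancel₀ _ hc]
      ring
    have hb : c₂ * (s * x) + d₂ * (t * y) = c₂ * s * δ - |κ| * y := by
      have : c₂ * s * δ - |κ| * y =
          c₂ * s * x + (s * s) * (c₂ * t * (d₁ / c₁) * y) + κ * t * y := by
        rw [hδ, ← ht]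
        ring
      rw [this, hss, hκ]
      field_simp
      ring
    rw [div_le_iff₀ hκ0] at hy
    rw [lt_div_iff₀ hc0] at h1
    refine ⟨(s * x, t * y), ?_, ?_, ?_⟩
    · push_cast
      rw [ha]
      positivity
    · push_cast
      rw [ha]
      linarith
    · push_cast
      rw [hb]
      have hs1 : |(s : ℝ)| = 1 := by
        have := abs_mul_abs_self (s : ℝ)
        rw [hss] at this
        nlinarith [abs_nonneg (s : ℝ)]
      have h2 : c₂ * s * δ ≤ |c₂| * (ε / |c₁|) := by
        calc c₂ * s * δ ≤ |c₂ * s * δ| := le_abs_self _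
          _ = |c₂| * δ := by rw [abs_mul, abs_mul, hs1, mul_one, abs_of_nonneg h0]
          _ ≤ |c₂| * (ε / |c₁|) := by
            gcongr
            rw [le_div_iff₀ hc0]
            exact h1.le
      linarith

/-- Along `v k` the second functional tends to `-∞`, so its half-plane disappears. The first tends
to `0` from the nonnegative side: points with a negative value are eventually lost, while points on
the boundary line are kept, as approach from below would not allow. -/
theorem exists_limit_functional {c₁ d₁ c₂ d₂ : ℝ} (hdet : c₁ * d₂ - d₁ * c₂ ≠ 0) :
    ∃ v : ℕ → ℤ × ℤ, ∀ p, ∀ᶠ k in Filter.atTop,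
      (0 ≤ functional c₁ d₁ (p + v k) ∨ 0 ≤ functional c₂ d₂ (p + v k) ↔
        0 ≤ functional c₁ d₁ p) := by
  choose v hv0 hv1 hv2 using fun k : ℕ =>
    exists_functional_lt hdet (ε := 1 / ((k : ℝ) + 1)) (by positivity) (k : ℝ)
  refine ⟨v, fun p => ?_⟩
  have h1 : ∀ᶠ k : ℕ in Filter.atTop, functional c₂ d₂ p < k :=
    tendsto_natCast_atTop_atTop.eventually_gt_atTop _
  have h2 : ∀ᶠ k : ℕ in Filter.atTop,
      functional c₁ d₁ p < 0 → 1 / ((k : ℝ) + 1) < -functional c₁ d₁ p := by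
    by_cases h : functional c₁ d₁ p < 0
    · filter_upwards [tendsto_one_div_add_atTop_nhds_zero_nat.eventually_lt_const
        (neg_pos.2 h)] with k hk _ using hk
    · exact Filter.Eventually.of_forall fun k hk => absurd hk h
  filter_upwards [h1, h2] with k hk1 hk2
  rw [map_add, map_add]
  have := hv0 k
  have := hv1 k
  have := hv2 k
  constructor
  · rintro (h | h)
    · by_contra! hp
      linarith [hk2 hp]
    · linarith
  · intro h
    left
    linarith

/-- Cramer's rule gives a real solution; rounding its coordinates down costs at most the sum of the
absolute coefficients. -/
theorem exists_functional_near {c₁ d₁ c₂ d₂ : ℝ} (hdet : c₁ * d₂ - d₁ * c₂ ≠ 0) (x y : ℝ) :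
    ∃ p, |functional c₁ d₁ p - x| ≤ |c₁| + |d₁| ∧ |functional c₂ d₂ p - y| ≤ |c₂| + |d₂| := by
  set s := (x * d₂ - y * d₁) / (c₁ * d₂ - d₁ * c₂) with hs
  set t := (c₁ * y - c₂ * x) / (c₁ * d₂ - d₁ * c₂) with ht
  have hx : c₁ * s + d₁ * t = x := by
    rw [hs, ht, mul_div_assoc', mul_div_assoc', ← add_div, div_eq_iff hdet]
    ring
  have hy : c₂ * s + d₂ * t = y := by
    rw [hs, ht, mul_div_assoc', mul_div_assoc', ← add_div, div_eq_iff hdet]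
    ring
  have hfloor : ∀ r : ℝ, |(⌊r⌋ : ℝ) - r| ≤ 1 := fun r => by
    rw [abs_le]
    constructor <;> linarith [Int.floor_le r, Int.lt_floor_add_one r]
  have key : ∀ c d : ℝ, |functional c d (⌊s⌋, ⌊t⌋) - (c * s + d * t)| ≤ |c| + |d| := fun c d => by
    rw [functional_apply]
    calc |c * (⌊s⌋ : ℝ) + d * (⌊t⌋ : ℝ) - (c * s + d * t)|
        = |c * ((⌊s⌋ : ℝ) - s) + d * ((⌊t⌋ : ℝ) - t)| := by ring_nf
      _ ≤ |c| * |(⌊s⌋ : ℝ) - s| + |d| * |(⌊t⌋ : ℝ) - t| := by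
        rw [← abs_mul, ← abs_mul]
        exact abs_add_le _ _
      _ ≤ |c| * 1 + |d| * 1 := by gcongr <;> exact hfloor _
      _ = |c| + |d| := by ring
  refine ⟨(⌊s⌋, ⌊t⌋), ?_, ?_⟩
  · rw [← hx]
    exact key _ _
  · rw [← hy]
    exact key _ _

/-- By Cramer's rule, bounds on both functionals bound both coordinates. -/
theorem finite_functional_box {c₁ d₁ c₂ d₂ : ℝ} (hdet : c₁ * d₂ - d₁ * c₂ ≠ 0) (N : ℝ) :
    {p | |functional c₁ d₁ p| ≤ N ∧ |functional c₂ d₂ p| ≤ N}.Finite := by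
  have hbound : ∀ e f g h : ℝ, |g| ≤ N → |h| ≤ N →
      |(g * e - h * f) / (c₁ * d₂ - d₁ * c₂)| ≤ (N * |e| + N * |f|) / |c₁ * d₂ - d₁ * c₂| := by
    intro e f g h hg hh
    rw [abs_div]
    gcongr
    refine (abs_sub _ _).trans ?_
    rw [abs_mul, abs_mul]
    gcongr
  have hint : ∀ (z : ℤ) (r : ℝ), |(z : ℝ)| ≤ r → z ∈ Set.Icc (-⌈r⌉) ⌈r⌉ := fun z r hz => by
    rw [abs_le] at hz
    have h := Int.le_ceil r
    constructor
    · have : ((-⌈r⌉ : ℤ) : ℝ) ≤ z := by push_cast; linarith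
      exact_mod_cast this
    · have : (z : ℝ) ≤ (⌈r⌉ : ℤ) := by linarith
      exact_mod_cast this
  refine ((Set.finite_Icc (-⌈(N * |d₂| + N * |d₁|) / |c₁ * d₂ - d₁ * c₂|⌉)
    ⌈(N * |d₂| + N * |d₁|) / |c₁ * d₂ - d₁ * c₂|⌉).prod
    (Set.finite_Icc (-⌈(N * |c₂| + N * |c₁|) / |c₁ * d₂ - d₁ * c₂|⌉)
    ⌈(N * |c₂| + N * |c₁|) / |c₁ * d₂ - d₁ * c₂|⌉)).subset ?_
  rintro p ⟨h1, h2⟩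
  refine ⟨hint _ _ ?_, hint _ _ ?_⟩
  · have h : (p.1 : ℝ) = (functional c₁ d₁ p * d₂ - functional c₂ d₂ p * d₁) /
        (c₁ * d₂ - d₁ * c₂) := by
      rw [eq_div_iff hdet, functional_apply, functional_apply]
      ring
    rw [h]
    exact hbound _ _ _ _ h1 h2
  · have h : (p.2 : ℝ) = -((functional c₁ d₁ p * c₂ - functional c₂ d₂ p * c₁) /
        (c₁ * d₂ - d₁ * c₂)) := by
      rw [← neg_div, eq_div_iff hdet, functional_apply, functional_apply]
      ring
    rw [h, abs_neg]
    exact hbound _ _ _ _ h1 h2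

/-- Linearly independent functionals cut out a corner. -/
theorem isCorner_functional {c₁ d₁ c₂ d₂ : ℝ} (hdet : c₁ * d₂ - d₁ * c₂ ≠ 0) :
    IsCorner (functional c₁ d₁) (functional c₂ d₂) := by
  have hdet' : c₂ * d₁ - d₂ * c₁ ≠ 0 := fun h => hdet (by linarith)
  have hnear : ∀ x y : ℝ, ∃ p, x ≤ functional c₁ d₁ p ∧
      functional c₁ d₁ p ≤ x + 2 * (|c₁| + |d₁|) ∧ y ≤ functional c₂ d₂ p ∧
      functional c₂ d₂ p ≤ y + 2 * (|c₂| + |d₂|) := fun x y => by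
    obtain ⟨p, h1, h2⟩ := exists_functional_near hdet (x + (|c₁| + |d₁|)) (y + (|c₂| + |d₂|))
    rw [abs_le] at h1 h2
    exact ⟨p, by linarith, by linarith, by linarith, by linarith⟩
  refine ⟨finite_functional_box hdet, fun N => ?_, fun N => ?_, fun N => ?_,
    exists_limit_functional hdet, ?_⟩
  · obtain ⟨p, h1, -, h2, -⟩ := hnear N N
    exact ⟨p, h1, h2⟩
  · obtain ⟨p, h1, -, -, h2⟩ := hnear N (-N - 2 * (|c₂| + |d₂|))
    exact ⟨p, h1, by linarith⟩
  · obtain ⟨p, -, h1, h2, -⟩ := hnear (-N - 2 * (|c₁| + |d₁|)) N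
    exact ⟨p, by linarith, h2⟩
  · simpa only [or_comm] using exists_limit_functional hdet'

/-! ### The half-planes of given slope as half-planes of functionals -/

theorem halfPlaneAbove_bot : halfPlaneAbove ⊥ = upper (functional 1 0) := by
  ext p
  simp [halfPlaneAbove, upper, functional_apply]

theorem halfPlaneAbove_coe (x : ℝ) : halfPlaneAbove x = upper (functional (-x) 1) := by
  ext p
  simp [halfPlaneAbove, upper, functional_apply]

theorem halfPlaneBelow_top : halfPlaneBelow ⊤ = upper (functional 1 0) := by
  ext p
  simp [halfPlaneBelow, upper, functional_apply]

theorem halfPlaneBelow_coe (x : ℝ) : halfPlaneBelow x = upper (functional x (-1)) := by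
  ext p
  simp only [halfPlaneBelow, upper, functional_apply, Set.mem_ofPred_eq, EReal.coe_ne_top,
    false_and, false_or, ne_eq, not_false_eq_true, true_and, EReal.toReal_coe]
  constructor <;> intro h <;> linarith

/-- The boundary lines of a concave corner are given by linearly independent functionals. -/
theorem exists_isCorner {α β : EReal} (hαβ : α < β) (hfin : ¬ (α = ⊥ ∧ β = ⊤)) :
    ∃ a b, IsCorner a b ∧ halfPlaneAbove α = upper a ∧ halfPlaneBelow β = upper b := by
  induction α with
  | bot =>
    induction β with
    | bot => exact absurd hαβ (lt_irrefl _)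
    | coe y =>
      exact ⟨_, _, isCorner_functional (by norm_num), halfPlaneAbove_bot, halfPlaneBelow_coe y⟩
    -- In this case both half-planes would be `x ≥ 0`, with equal functionals.
    | top => exact absurd ⟨rfl, rfl⟩ hfin
  | coe x =>
    induction β with
    | bot => exact absurd hαβ not_lt_bot
    | coe y =>
      have h : x < y := EReal.coe_lt_coe_iff.1 hαβ
      -- The determinant is `x - y`.
      refine ⟨_, _, isCorner_functional ?_, halfPlaneAbove_coe x, halfPlaneBelow_coe y⟩
      intro h'
      linarith
    | top =>
      exact ⟨_, _, isCorner_functional (by norm_num), halfPlaneAbove_coe x, halfPlaneBelow_top⟩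
  | top => exact absurd hαβ not_top_lt

theorem hasExactSequence_concaveCorner {α β : EReal} (hαβ : α < β) (hfin : ¬ (α = ⊥ ∧ β = ⊤)) :
    HasExactSequence (concaveCorner α β) (halfPlaneAbove α) (halfPlaneBelow β) := by
  obtain ⟨a, b, hab, ha, hb⟩ := exists_isCorner hαβ hfin
  rw [concaveCorner, ha, hb]
  exact hab.hasExactSequence fun _ => Iff.rfl

end ConcaveCorner

end

theorem theorem2p5 (α β : EReal) (hαβ : α < β) (hfin : ¬ (α = ⊥ ∧ β = ⊤)) :
    ∃ (σα : ConcaveCorner.toeplitzAlgebra (ConcaveCorner.halfPlaneAbove α) →⋆ₐ[ℂ]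
          C(Circle × Circle, ℂ))
      (σβ : ConcaveCorner.toeplitzAlgebra (ConcaveCorner.halfPlaneBelow β) →⋆ₐ[ℂ]
          C(Circle × Circle, ℂ)),
      ConcaveCorner.IsSymbolMap σα ∧ ConcaveCorner.IsSymbolMap σβ ∧
      ∃ (ι : ConcaveCorner.compactOperators
              (ConcaveCorner.SubHilbert (ConcaveCorner.concaveCorner α β)) →⋆ₙₐ[ℂ]
            ConcaveCorner.toeplitzAlgebra (ConcaveCorner.concaveCorner α β))
        (γ : ConcaveCorner.toeplitzAlgebra (ConcaveCorner.concaveCorner α β) →⋆ₐ[ℂ]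
            ConcaveCorner.pullback σα σβ),
        -- `ι` is the inclusion of operators
        (∀ T, (ι T).1 = T.1) ∧
        -- `γ` sends compressed translations to the pairs of half-plane compressions
        (∀ m n : ℤ, (γ (ConcaveCorner.toeplitzGen (ConcaveCorner.concaveCorner α β) m n)).1 =
          (ConcaveCorner.toeplitzGen (ConcaveCorner.halfPlaneAbove α) m n,
            ConcaveCorner.toeplitzGen (ConcaveCorner.halfPlaneBelow β) m n)) ∧
        -- exactness of `0 → K → T → S → 0`
        Function.Injective ι ∧ Function.Exact ι γ ∧ Function.Surjective γ :=
  ConcaveCorner.hasExactSequence_concaveCorner hαβ hfin
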